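/- **Theorem 6 (Rate of CD-BAC$_q$).** Let $A,\beta,\gamma>0$, $0<E\le A$, $Q(x)=\frac1{\sqrt{2\pi}}\int_x^\infty e^{-u^2/2}\,du$, $\bar\epsilon=2Q(\beta)$, $N=\lceil\log_2(\gamma(A+2\beta))\rceil$, $q\in\{1,\dots,N-1\}$, and let $\mathcal T_0,\dots,\mathcal T_{N-1}\subseteq\{0,1\}^q$. *Channel.* Let $K$ be an integer noise, independent of the input, with $$\mathcal P\{K=k\}=\frac{Q\big(\frac{k-\gamma\beta}{\gamma}\big)-Q\big(\frac{k+1-\gamma\beta}{\gamma}\big)}{Q\big(\frac{-\lceil\gamma A\rceil-\gamma\beta}{\gamma}\big)-Q\big(\frac{\lceil\gamma(A+2\beta)\rceil-\gamma\beta}{\gamma}\big)},\qquad -\lceil\gamma A\rceil\le k<\lceil\gamma(A+2\beta)\rceil$$ (the law of $\lfloor\gamma(Z+\beta)\rfloor$ for a standard Gaussian $Z$, conditioned on this range). Let $Z_i^b$, $0\le i<N$, be the bits of the $N$-bit two's complement representation of $K$ ($i=0$ is the least significant bit) and $\alpha_i=\mathcal P\{Z_i^b=1\}$. In one use, an input $(X_0^b,\dots,X_{N-1}^b)\in\{0,1\}^N$,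 sent as the intensity $X=\frac1\gamma\sum_i 2^iX_i^b$, yields $Y_i^b=(X_i^b+Z_i^b+W_i^b)\bmod 2$, where $W_0^b=0$ and $W_{i+1}^b=(X_i^bZ_i^b+X_i^bW_i^b+Z_i^bW_i^b)\bmod 2$. Put $Y_i^b=0$ for $i\ge N$. The whole output vector is erased with a probability $\epsilon\in[0,\bar\epsilon]$, independently of the input and the noise. Uses are independent. *Scheme.* Each bit-pipe $i$ has its own message, encoded by its own binary block code; bit-pipes with $p_i=0$ carry no message and always send $0$. Every transmitted block must satisfy $X\le A$ at each time and have time average of $X$ at most $E$. The receiver proceeds through $i=0,1,\dots,N-1$: at unerased times it adds its reconstruction of $W_i^b$ to $Y_i^b$ modulo $2$, changes the result from $0$ to $1$ whenever $\boldsymbol T_i^b=(Y_{i+1}^b,\dots,Y_{i+q}^b)\in\mathcal T_i$, decodes message $i$ from the resulting bits $\check Y_i^b$ and the erasures alone, and from the re-encoded decision reconstructs $Z_i^b$ and $W_{i+1}^b$. For $p\in[0,1]^N$ let $X_i^b\sim\mathrm{Bern}(p_i)$ be independent, and put $$\theta_i=\mathcal P\{\boldsymbol T_i^b\in\mathcal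 T_i\mid (X_i^b,Z_i^b)=(0,0)\},\qquad \bar\theta_i=\mathcal P\{\boldsymbol T_i^b\in\mathcal T_i\mid (X_i^b,Z_i^b)=(1,1)\},$$ $$\tilde\alpha_{i0}=\alpha_i+(1-\alpha_i)\theta_i,\qquad \tilde\alpha_{i1}=\alpha_i-\alpha_i\bar\theta_i,$$ $$\Phi_i(p)=\mathsf h\big((1-p_i)\tilde\alpha_{i0}+p_i(1-\tilde\alpha_{i1})\big)-(1-p_i)\,\mathsf h(\tilde\alpha_{i0})-p_i\,\mathsf h(\tilde\alpha_{i1}),$$ where $\mathsf h$ is the binary entropy function in bits (a conditional probability given a null event is taken to be $0$; this does not affect $\Phi_i$). Then: 1. For every $p\in[0,1]^N$ and every $i$, with exactly reconstructed carry bits and no erasure, the flipped output satisfies $\mathcal P\{\check Y_i^b=1\mid X_i^b=0\}=\tilde\alpha_{i0}$ if $p_i\ne1$, $\mathcal P\{\check Y_i^b=0\mid X_i^b=1\}=\tilde\alpha_{i1}$ if $p_i\neq0$, and $\Phi_i(p)=I(X_i^b;\check Y_i^b)$. 2. Over all $p\in[0,1]^N$ with $\sum_{i:\,p_i>0}2^i\le\gamma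 A$ and $\sum_{i:\,p_i>0}p_i2^i\le\gamma E$, the sum $\sum_{i=0}^{N-1}\Phi_i(p)$ has a maximum, and for a maximizer $p$ and every $\epsilon\in[0,\bar\epsilon]$ the scheme achieves the rate $$R_{\mathrm{CD\text{-}BAC}_q}=(1-\bar\epsilon)\max_p\sum_{i=0}^{N-1}\Phi_i(p)$$ bits per channel use. That is, for every $R'<R_{\mathrm{CD\text{-}BAC}_q}$ and $\delta>0$ and all sufficiently large block lengths, there are codes as above of total rate at least $R'$ whose probability that some message is decoded wrongly, averaged over independent uniform messages, is at most $\delta$. -/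

import Mathlib

open scoped BigOperators

noncomputable section

namespace CDBAC

/-! ### Noise, bit-pipes and carry bits -/

/-- Tail function of the standard Gaussian distribution. -/
def gaussQ (x : ℝ) : ℝ :=
  (1 / Real.sqrt (2 * Real.pi)) * ∫ u in Set.Ioi x, Real.exp (-u ^ 2 / 2)

/-- Upper bound `2 Q(β)` on the erasure probability. -/
def epsBar (β : ℝ) : ℝ := 2 * gaussQ β

/-- The values `k` that the quantized noise `⌊γ (Z + β)⌋` takes in the model. -/
def noiseRange (A β γ : ℝ) : Finset ℤ := Finset.Ico (-⌈γ * A⌉) ⌈γ * (A + 2 * β)⌉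

/-- Probability that `⌊γ (Z + β)⌋ = k`, for `Z` standard Gaussian conditioned on
`-⌈γ A⌉ ≤ γ (Z + β) < ⌈γ (A + 2 β)⌉` (used for `k ∈ noiseRange A β γ`). -/
def noiseProb (A β γ : ℝ) (k : ℤ) : ℝ :=
  (gaussQ (((k : ℝ) - γ * β) / γ) - gaussQ (((k : ℝ) + 1 - γ * β) / γ)) /
    (gaussQ ((-(⌈γ * A⌉ : ℝ) - γ * β) / γ) -
      gaussQ (((⌈γ * (A + 2 * β)⌉ : ℝ) - γ * β) / γ))

/-- Bit `i` of the `N`-bit two's complement representation of the integer noise `k`. -/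
def noiseBit (N : ℕ) (k : ℤ) (i : ℕ) : Bool :=
  decide ((((if k < 0 then 2 ^ N else 0) + k) / 2 ^ i) % 2 = 1)

/-- A vector of `N` bits, continued by zeros. -/
def bitAt {N : ℕ} (x : Fin N → Bool) (i : ℕ) : Bool :=
  if h : i < N then x ⟨i, h⟩ else false

/-- The carry-over bit produced by three bits: `ab + ac + bc` modulo 2. -/
def carryOut (a b c : Bool) : Bool := xor (xor (a && b) (a && c)) (b && c)

/-- The carry-over bit `W_i` entering bit-pipe `i`. -/
def carry {N : ℕ} (x : Fin N → Bool) (k : ℤ) : ℕ → Bool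
  | 0 => false
  | i + 1 => carryOut (bitAt x i) (noiseBit N k i) (carry x k i)

/-- Outputs of the vector binary channel: `Y_i = X_i + Z_i + W_i` modulo 2. -/
def output {N : ℕ} (x : Fin N → Bool) (k : ℤ) : Fin N → Bool :=
  fun i => xor (xor (x i) (noiseBit N k i)) (carry x k i)

/-- Transition probability of one use of the vector binary channel in which, independently of
everything else, the whole output vector is erased (`none`) with probability `ε`. -/
def transProb (A β γ ε : ℝ) {N : ℕ} (x : Fin N → Bool) : Option (Fin N → Bool) → ℝ
  | none => ε
  | some y => (1 - ε) * ∑ k ∈ noiseRange A β γ, if output x k = y then noiseProb A β γ k else 0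

/-! ### The flipping rule -/

/-- The outputs of the `q` bit-pipes above bit-pipe `i` (zero beyond the last bit-pipe). -/
def upper {N : ℕ} (q : ℕ) (y : Fin N → Bool) (i : Fin N) : Fin q → Bool :=
  fun j => bitAt y (i + 1 + j)

/-- Output of bit-pipe `i` after removal of the carry bit `w`, with `0` flipped to `1` when the
higher outputs lie in the set `S`. -/
def flipped {N q : ℕ} (S : Finset (Fin q → Bool)) (y : Fin N → Bool) (w : Bool) (i : Fin N) :
    Bool :=
  if xor (y i) w = false ∧ upper q y i ∈ S then true else xor (y i) w

/-! ### Law of one unerased channel use with independent Bernoulli inputs -/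

/-- Probability of the input vector `x` when the bits are independent, bit `i` being
Bernoulli with parameter `p i`. -/
def inputProb {N : ℕ} (p : Fin N → ℝ) (x : Fin N → Bool) : ℝ :=
  ∏ i, if x i then p i else 1 - p i

open Classical in
/-- Probability of an event on the input vector and the (independent) integer noise. -/
def prob (A β γ : ℝ) {N : ℕ} (p : Fin N → ℝ) (F : (Fin N → Bool) → ℤ → Prop) : ℝ :=
  ∑ x : Fin N → Bool, ∑ k ∈ noiseRange A β γ,
    if F x k then inputProb p x * noiseProb A β γ k else 0

/-- Conditional probability of `F` given `G`. -/
def condProb (A β γ : ℝ) {N : ℕ} (p : Fin N → ℝ) (F G : (Fin N → Bool) → ℤ → Prop) : ℝ :=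
  prob A β γ p (fun x k => F x k ∧ G x k) / prob A β γ p G

/-- `α_i`, the probability that noise bit `i` equals one. -/
def alpha (A β γ : ℝ) {N : ℕ} (i : Fin N) : ℝ :=
  ∑ k ∈ (noiseRange A β γ).filter (fun k => noiseBit N k i = true), noiseProb A β γ k

/-- `θ_i`: probability that the higher outputs lie in `T i` given `(X_i, Z_i) = (0, 0)`. -/
def theta (A β γ : ℝ) {N q : ℕ} (T : Fin N → Finset (Fin q → Bool)) (p : Fin N → ℝ)
    (i : Fin N) : ℝ :=
  condProb A β γ p (fun x k => upper q (output x k) i ∈ T i)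
    (fun x k => x i = false ∧ noiseBit N k i = false)

/-- `θ̄_i`: probability that the higher outputs lie in `T i` given `(X_i, Z_i) = (1, 1)`. -/
def thetaBar (A β γ : ℝ) {N q : ℕ} (T : Fin N → Finset (Fin q → Bool)) (p : Fin N → ℝ)
    (i : Fin N) : ℝ :=
  condProb A β γ p (fun x k => upper q (output x k) i ∈ T i)
    (fun x k => x i = true ∧ noiseBit N k i = true)

/-- Crossover probability from `0` to `1`. -/
def alphaZero (A β γ : ℝ) {N q : ℕ} (T : Fin N → Finset (Fin q → Bool)) (p : Fin N → ℝ)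
    (i : Fin N) : ℝ :=
  alpha A β γ i + (1 - alpha A β γ i) * theta A β γ T p i

/-- Crossover probability from `1` to `0`. -/
def alphaOne (A β γ : ℝ) {N q : ℕ} (T : Fin N → Finset (Fin q → Bool)) (p : Fin N → ℝ)
    (i : Fin N) : ℝ :=
  alpha A β γ i - alpha A β γ i * thetaBar A β γ T p i

/-- Binary entropy function in bits. -/
def hBin (x : ℝ) : ℝ := Real.binEntropy x / Real.log 2

/-- The rate term `Φ_i` of bit-pipe `i`. -/
def Phi (A β γ : ℝ) {N q : ℕ} (T : Fin N → Finset (Fin q → Bool)) (p : Fin N → ℝ)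
    (i : Fin N) : ℝ :=
  hBin ((1 - p i) * alphaZero A β γ T p i + p i * (1 - alphaOne A β γ T p i))
    - (1 - p i) * hBin (alphaZero A β γ T p i) - p i * hBin (alphaOne A β γ T p i)

/-- The flipped output of bit-pipe `i` in one unerased channel use. -/
def flippedOutput {N q : ℕ} (T : Fin N → Finset (Fin q → Bool)) (i : Fin N)
    (x : Fin N → Bool) (k : ℤ) : Bool :=
  flipped (T i) (output x k) (carry x k i) i

/-- Mutual information, in bits, of two binary variables with joint probability function `J`. -/
def mutualInfo (J : Bool → Bool → ℝ) : ℝ :=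
  ∑ a : Bool, ∑ b : Bool, J a b * Real.logb 2 (J a b / ((∑ b', J a b') * ∑ a', J a' b))

/-! ### Input parameters and codes -/

/-- Admissible Bernoulli parameters. The bit-pipes with `0 < p i` are the active ones. -/
def Feasible (A E γ : ℝ) {N : ℕ} (p : Fin N → ℝ) : Prop :=
  (∀ i, 0 ≤ p i ∧ p i ≤ 1) ∧
  (∑ i ∈ Finset.univ.filter (fun i => 0 < p i), (2 : ℝ) ^ (i : ℕ)) ≤ γ * A ∧
  (∑ i ∈ Finset.univ.filter (fun i => 0 < p i), p i * (2 : ℝ) ^ (i : ℕ)) ≤ γ * E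

/-- A separate binary block code of length `n` for each of `N` bit-pipes; each bit-pipe decoder
sees `n` symbols, each a bit or an erasure. -/
structure Code (N n : ℕ) where
  size : Fin N → ℕ
  size_pos : ∀ i, 0 < size i
  enc : (i : Fin N) → Fin (size i) → Fin n → Bool
  dec : (i : Fin N) → (Fin n → Option Bool) → Fin (size i)

namespace Code

variable {N n : ℕ}

/-- Input vector of the channel at time `t` for the message tuple `m`. -/
def input (C : Code N n) (m : (i : Fin N) → Fin (C.size i)) (t : Fin n) : Fin N → Bool :=
  fun i => C.enc i (m i) t

/-- Transmitted intensity at time `t` for the message tuple `m`. -/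
def intensity (C : Code N n) (γ : ℝ) (m : (i : Fin N) → Fin (C.size i)) (t : Fin n) : ℝ :=
  (∑ i : Fin N, if C.input m t i then (2 : ℝ) ^ (i : ℕ) else 0) / γ

/-- Every transmitted block obeys the peak constraint `A` and the average constraint `E`. -/
def MeetsConstraints (C : Code N n) (A E γ : ℝ) : Prop :=
  ∀ m : (i : Fin N) → Fin (C.size i),
    (∀ t, C.intensity γ m t ≤ A) ∧ ∑ t, C.intensity γ m t ≤ n * E

/-- The bit-pipes with `p i = 0` carry no message and always send zero. -/
def RespectsOff (C : Code N n) (p : Fin N → ℝ) : Prop :=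
  ∀ i, p i = 0 → C.size i = 1 ∧ ∀ m t, C.enc i m t = false

/-- The sequence handed to the decoder of bit-pipe `i`, when the carry bits that enter this
bit-pipe are believed to be `w`. -/
def decoderInput {q : ℕ} (T : Fin N → Finset (Fin q → Bool)) (y : Fin n → Option (Fin N → Bool))
    (w : Fin n → Bool) (i : Fin N) : Fin n → Option Bool :=
  fun t => (y t).map (fun v => flipped (T i) v (w t) i)

/-- The carry bits entering bit-pipe `i` as the receiver reconstructs them: after decoding a
bit-pipe it re-encodes the decision, deduces the noise bit and computes the next carry bit
(at erased times the value is immaterial). -/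
def carryEst {q : ℕ} (C : Code N n) (T : Fin N → Finset (Fin q → Bool))
    (y : Fin n → Option (Fin N → Bool)) : ℕ → Fin n → Bool
  | 0 => fun _ => false
  | i + 1 => fun t =>
      if h : i < N then
        match y t with
        | none => false
        | some v =>
            let w : Bool := carryEst C T y i t
            let x : Bool :=
              C.enc ⟨i, h⟩ (C.dec ⟨i, h⟩ (decoderInput T y (carryEst C T y i) ⟨i, h⟩)) t
            carryOut x (xor (xor (v ⟨i, h⟩) x) w) w
      else false

/-- Decision of the successive receiver about the message of bit-pipe `i`. -/
def decide {q : ℕ} (C : Code N n) (T : Fin N → Finset (Fin q → Bool))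
    (y : Fin n → Option (Fin N → Bool)) (i : Fin N) : Fin (C.size i) :=
  C.dec i (decoderInput T y (C.carryEst T y i) i)

/-- Probability that at least one message is decoded wrongly, for independent uniform messages
and `n` independent uses of the channel. -/
def errorProb {q : ℕ} (C : Code N n) (A β γ ε : ℝ) (T : Fin N → Finset (Fin q → Bool)) : ℝ :=
  (∑ m : (i : Fin N) → Fin (C.size i), ∑ y : Fin n → Option (Fin N → Bool),
    if C.decide T y = m then 0 else ∏ t, transProb A β γ ε (C.input m t) (y t)) /
    ∏ i, (C.size i : ℝ)

/-- Total rate in bits per channel use. -/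
def rate (C : Code N n) : ℝ := (∑ i, Real.logb 2 (C.size i)) / n

end Code

/-- The scheme with flipping sets `T` and active bit-pipes given by `p` achieves the rate `R` over
the channel with erasure probability `ε`: every smaller rate is attained, for all large block
lengths, with error probability as small as desired. -/
def Achieves (A E β γ ε : ℝ) {N q : ℕ} (T : Fin N → Finset (Fin q → Bool)) (p : Fin N → ℝ)
    (R : ℝ) : Prop :=
  ∀ R' < R, ∀ δ > 0, ∃ n₀ : ℕ, ∀ n ≥ n₀, ∃ C : Code N n,
    C.RespectsOff p ∧ C.MeetsConstraints A E γ ∧ R' ≤ C.rate ∧ C.errorProb A β γ ε T ≤ δ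

end CDBAC

end

/-!
A receiver whose earlier decisions are correct knows every carry bit, so bit-pipe `i` acts as a
memoryless channel from `X_i` to the flipped output, erased with probability `ε`; the other pipes
enter only through the law of their inputs. This channel has crossover probabilities `α̃_{i0}` and
`α̃_{i1}`, so its mutual information is `(1 - ε) Φ_i(p)`. A union bound over the bit-pipes thus
replaces the successive receiver by separate receivers that are given the true carry bits.

The intensity constraints hold for every codeword once the codeword of pipe `i` has weight at most
`n p_i` and the pipes with `p_i = 0` stay silent. Codewords are drawn with i.i.d. bits of parameter
`p'_i < p_i`, conditioned on this weight bound. By the law of large numbers the conditioning at most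
doubles each probability, so the usual random coding estimate for a receiver that thresholds the
information density survives: the Chernoff bound makes its errors exponentially small at every rate
below the mutual information. Since the pipes interact, one averages over the codebooks of all pipes
at once. Letting `p' = τ p` with `τ → 1` and using the continuity of `Φ_i` gives the rate at `p`.

The peak constraint reads `∑_{p_i > 0} 2^i ≤ γ A`, a lower semicontinuous function of `p` being
bounded, so the admissible parameters form a compact set and a maximizer exists.
-/

namespace CDBAC

open Finset Filter

noncomputable section

section FiniteLaws

variable {ι κ X Y R : Type*} [Fintype ι]

/-- The law of independent variables with laws `w i`. -/
def prodLaw (w : ι → X → ℝ) (x : ι → X) : ℝ := ∏ i, w i (x i)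

/-- The law of `n` independent variables with law `μ`. -/
abbrev iidLaw (n : ℕ) (μ : X → ℝ) : (Fin n → X) → ℝ := prodLaw fun _ => μ

open Classical in
/-- The law of `φ x` when `x` has law `μ`. -/
def mapLaw [Fintype X] (μ : X → ℝ) (φ : X → R) (r : R) : ℝ := ∑ x with φ x = r, μ x

/-- The joint law of the input and the output of a channel `W` whose input has law `μ`. -/
def jointLaw (μ : X → ℝ) (W : X → Y → ℝ) (s : X × Y) : ℝ := μ s.1 * W s.1 s.2

lemma prodLaw_nonneg {w : ι → X → ℝ} (hw : ∀ i x, 0 ≤ w i x) (x : ι → X) : 0 ≤ prodLaw w x :=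
  prod_nonneg fun i _ => hw i (x i)

variable [Fintype X]

lemma sum_prodLaw_mul_prod [DecidableEq ι] (w F : ι → X → ℝ) :
    ∑ x, prodLaw w x * ∏ i, F i (x i) = ∏ i, ∑ a, w i a * F i a := by
  simp only [prodLaw, ← prod_mul_distrib, prod_univ_sum, Fintype.piFinset_univ]

lemma sum_prodLaw [DecidableEq ι] (w : ι → X → ℝ) : ∑ x, prodLaw w x = ∏ i, ∑ a, w i a := by
  simp only [prodLaw, prod_univ_sum, Fintype.piFinset_univ]

lemma prodLaw_mem_stdSimplex [DecidableEq ι] {w : ι → X → ℝ} (hw : ∀ i, w i ∈ stdSimplex ℝ X) :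
    prodLaw w ∈ stdSimplex ℝ (ι → X) :=
  ⟨prodLaw_nonneg fun i => (hw i).1, by simp only [sum_prodLaw, (hw _).2, prod_const_one]⟩

lemma exists_ne_zero_le_of_sum_mul_le {μ : X → ℝ} (hμ : μ ∈ stdSimplex ℝ X) {F : X → ℝ} {B : ℝ}
    (h : ∑ x, μ x * F x ≤ B) : ∃ x, μ x ≠ 0 ∧ F x ≤ B := by
  by_contra! hF
  obtain ⟨x, -, hx⟩ := exists_ne_zero_of_sum_ne_zero (hμ.2.trans_ne one_ne_zero)
  refine h.not_gt ?_
  rw [← one_mul B, ← hμ.2, sum_mul]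
  refine sum_lt_sum (fun y _ => ?_)
    ⟨x, mem_univ x, mul_lt_mul_of_pos_left (hF x hx) ((hμ.1 x).lt_of_ne' hx)⟩
  rcases eq_or_ne (μ y) 0 with hy | hy
  · rw [hy, zero_mul, zero_mul]
  · exact mul_le_mul_of_nonneg_left (hF y hy).le (hμ.1 y)

lemma mapLaw_nonneg {μ : X → ℝ} (hμ : ∀ x, 0 ≤ μ x) (φ : X → R) (r : R) : 0 ≤ mapLaw μ φ r :=
  sum_nonneg fun x _ => hμ x

lemma sum_mapLaw_mul [Fintype R] (μ : X → ℝ) (φ : X → R) (F : R → ℝ) :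
    ∑ r, mapLaw μ φ r * F r = ∑ x, μ x * F (φ x) := by
  classical
  rw [← sum_fiberwise univ φ]
  refine sum_congr rfl fun r _ => ?_
  rw [mapLaw, sum_mul]
  exact sum_congr (by congr) fun x hx => by rw [(mem_filter.1 hx).2]

lemma mapLaw_mem_stdSimplex [Fintype R] {μ : X → ℝ} (hμ : μ ∈ stdSimplex ℝ X) (φ : X → R) :
    mapLaw μ φ ∈ stdSimplex ℝ R :=
  ⟨mapLaw_nonneg hμ.1 φ, by simpa [hμ.2] using sum_mapLaw_mul μ φ 1⟩

lemma mapLaw_eq_sum_mul_indicator (μ : X → ℝ) (φ : X → R) (r : R) :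
    mapLaw μ φ r = ∑ x, μ x * (φ ⁻¹' {r}).indicator 1 x := by
  classical
  simp [mapLaw, sum_filter, Set.indicator_apply]

lemma mapLaw_comp [Fintype Y] (μ : X → ℝ) (φ : X → Y) (ψ : Y → R) :
    mapLaw (mapLaw μ φ) ψ = mapLaw μ (ψ ∘ φ) := by
  ext r
  rw [mapLaw_eq_sum_mul_indicator, sum_mapLaw_mul, mapLaw_eq_sum_mul_indicator]
  rfl

lemma mapLaw_prodLaw [DecidableEq ι] (w : ι → X → ℝ) (φ : ι → X → R) :
    mapLaw (prodLaw w) (fun x i => φ i (x i)) = prodLaw fun i => mapLaw (w i) (φ i) := by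
  classical
  ext r
  simp only [mapLaw, prodLaw, prod_univ_sum]
  exact sum_congr (by ext x; simp [funext_iff]) fun _ _ => rfl

lemma mapLaw_prodLaw_comp [DecidableEq ι] [Fintype κ] {w : ι → X → ℝ}
    (hw : ∀ i, ∑ x, w i x = 1) {σ : κ → ι} (hσ : σ.Injective) :
    mapLaw (prodLaw w) (fun x k => x (σ k)) = prodLaw fun k => w (σ k) := by
  classical
  ext g
  have hfiber : (univ.filter fun x : ι → X => (fun k => x (σ k)) = g) =
      Fintype.piFinset fun i => univ.filter fun a => ∀ k, σ k = i → a = g k := by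
    ext x
    simp only [mem_filter, mem_univ, true_and, Fintype.mem_piFinset, funext_iff]
    exact ⟨fun h i k hk => hk ▸ h k, fun h k => h (σ k) k rfl⟩
  have hoff : ∀ i ∈ univ, i ∉ univ.image σ →
      ∑ a with ∀ k, σ k = i → a = g k, w i a = 1 := by
    intro i _ hi
    rw [filter_true_of_mem fun a _ k hk => absurd (mem_image.2 ⟨k, mem_univ k, hk⟩) hi, hw]
  have hon : ∀ k, ∑ a with ∀ k', σ k' = σ k → a = g k', w (σ k) a = w (σ k) (g k) := by
    simp [hσ.eq_iff, sum_filter]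
  calc mapLaw (prodLaw w) (fun x k => x (σ k)) g
      = ∏ i, ∑ a with ∀ k, σ k = i → a = g k, w i a := by
        rw [prod_univ_sum, ← hfiber, mapLaw]
        exact sum_congr (by congr) fun _ _ => rfl
    _ = ∏ i ∈ univ.image σ, ∑ a with ∀ k, σ k = i → a = g k, w i a :=
        (prod_subset (subset_univ _) hoff).symm
    _ = prodLaw (fun k => w (σ k)) g := by
        rw [prod_image hσ.injOn]; exact prod_congr rfl fun k _ => hon k

lemma mapLaw_prodLaw_eval [DecidableEq ι] {w : ι → X → ℝ} (hw : ∀ i, ∑ x, w i x = 1) (i : ι) :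
    mapLaw (prodLaw w) (fun x => x i) = w i := by
  ext a
  have hmarginal := congrFun
    (mapLaw_prodLaw_comp hw (Function.injective_of_subsingleton fun _ : Unit => i)) fun _ => a
  rw [prodLaw, Fintype.prod_unique] at hmarginal
  rw [← hmarginal, mapLaw, mapLaw]
  congr! with x
  exact ⟨fun h => funext fun _ => h, fun h => congrFun h ()⟩

variable [Fintype Y]

lemma jointLaw_mem_stdSimplex {μ : X → ℝ} (hμ : μ ∈ stdSimplex ℝ X) {W : X → Y → ℝ}
    (hW : ∀ x, W x ∈ stdSimplex ℝ Y) : jointLaw μ W ∈ stdSimplex ℝ (X × Y) :=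
  ⟨fun s => mul_nonneg (hμ.1 _) ((hW _).1 _), by
    simp only [jointLaw, Fintype.sum_prod_type, ← mul_sum, (hW _).2, mul_one, hμ.2]⟩

lemma mapLaw_jointLaw_fst (μ : X → ℝ) {W : X → Y → ℝ} (hW : ∀ x, ∑ y, W x y = 1) :
    mapLaw (jointLaw μ W) Prod.fst = μ := by
  classical
  ext x
  simp only [mapLaw, jointLaw, sum_filter, Fintype.sum_prod_type, sum_ite_irrel, ← mul_sum, hW,
    mul_one, sum_const_zero, sum_ite_eq', mem_univ, if_true]

end FiniteLaws

section Chernoff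

variable {R : Type*} [Fintype R]

lemma exists_pos_sum_mul_exp_lt_one {ν : R → ℝ} (hν : ∑ r, ν r = 1) {ℓ : R → ℝ} {c : ℝ}
    (hc : c < ∑ r, ν r * ℓ r) : ∃ s > 0, ∑ r, ν r * Real.exp (s * (c - ℓ r)) < 1 := by
  set G : ℝ → ℝ := fun s => ∑ r, ν r * Real.exp (s * (c - ℓ r)) with hG
  have hG0 : G 0 = 1 := by simp [hG, hν]
  have hderiv : HasDerivAt G (c - ∑ r, ν r * ℓ r) 0 := by
    have hsum : c - ∑ r, ν r * ℓ r = ∑ r, ν r * (c - ℓ r) := by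
      simp only [mul_sub, sum_sub_distrib, ← sum_mul, hν, one_mul]
    rw [hsum]
    refine HasDerivAt.fun_sum fun r _ => ?_
    simpa using (((hasDerivAt_id (0 : ℝ)).mul_const (c - ℓ r)).exp).const_mul (ν r)
  have hslope := (hasDerivWithinAt_iff_tendsto_slope' (by simp)).1
    (hderiv.hasDerivWithinAt (s := Set.Ioi 0))
  obtain ⟨s, hs, hs0⟩ :=
    ((hslope.eventually_lt_const (sub_neg.2 hc)).and self_mem_nhdsWithin).exists
  rw [slope_def_field, hG0, sub_zero, div_lt_iff₀ hs0, zero_mul, sub_neg] at hs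
  exact ⟨s, hs0, hs⟩

lemma exists_chernoff {ν : R → ℝ} (hν : ν ∈ stdSimplex ℝ R) {ℓ : R → ℝ} {c : ℝ}
    (hc : c < ∑ r, ν r * ℓ r) :
    ∃ ρ : ℝ, 0 ≤ ρ ∧ ρ < 1 ∧ ∀ n : ℕ, ∑ r : Fin n → R,
      iidLaw n ν r * {r | ∑ t, ℓ (r t) ≤ n * c}.indicator 1 r ≤ ρ ^ n := by
  obtain ⟨s, hs, hlt⟩ := exists_pos_sum_mul_exp_lt_one hν.2 hc
  refine ⟨_, sum_nonneg fun r _ => mul_nonneg (hν.1 r) (Real.exp_pos _).le, hlt, fun n => ?_⟩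
  calc ∑ r : Fin n → R, iidLaw n ν r * {r | ∑ t, ℓ (r t) ≤ n * c}.indicator 1 r
      ≤ ∑ r : Fin n → R, iidLaw n ν r * ∏ t, Real.exp (s * (c - ℓ (r t))) := by
        refine sum_le_sum fun r _ => mul_le_mul_of_nonneg_left ?_ (prodLaw_nonneg (fun _ => hν.1) r)
        rw [← Real.exp_sum, Set.indicator_apply]
        split_ifs with hr
        · rw [Set.mem_ofPred, ← sub_nonneg] at hr
          refine Real.one_le_exp ?_
          rw [← mul_sum, sum_sub_distrib, sum_const, card_univ, Fintype.card_fin, nsmul_eq_mul]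
          exact mul_nonneg hs.le hr
        · exact (Real.exp_pos _).le
    _ = (∑ r, ν r * Real.exp (s * (c - ℓ r))) ^ n := by
        rw [sum_prodLaw_mul_prod (fun _ => ν) fun _ r => Real.exp (s * (c - ℓ r)), prod_const,
          card_univ, Fintype.card_fin]

end Chernoff

section Information

variable {R X V : Type*}

lemma sum_log_div_le {J B : R → ℝ} (hJ : ∀ r, 0 ≤ J r) (hB : ∀ r, 0 ≤ B r)
    (hJB : ∀ r, B r = 0 → J r = 0) {n : ℕ} {r : Fin n → R} (hr : 0 < iidLaw n J r) {a : ℝ}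
    (hle : iidLaw n J r ≤ Real.exp a * iidLaw n B r) :
    ∑ t, Real.log (J (r t) / B (r t)) ≤ a := by
  have hJr : ∀ t, 0 < J (r t) := fun t =>
    (hJ _).lt_of_ne' fun h => hr.ne' (prod_eq_zero (mem_univ t) h)
  have hBr : ∀ t, 0 < B (r t) := fun t => (hB _).lt_of_ne' fun h => (hJr t).ne' (hJB _ h)
  rw [← Real.log_prod fun t _ => (div_pos (hJr t) (hBr t)).ne', prod_div_distrib,
    Real.log_le_iff_le_exp (div_pos (prod_pos fun t _ => hJr t) (prod_pos fun t _ => hBr t)),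
    div_le_iff₀ (prod_pos fun t _ => hBr t)]
  exact hle

lemma exists_threshold_test [Fintype R] {J B : R → ℝ} (hJ : J ∈ stdSimplex ℝ R) (hB : ∀ r, 0 ≤ B r)
    (hJB : ∀ r, B r = 0 → J r = 0) {c : ℝ} (hc : c < ∑ r, J r * Real.log (J r / B r)) :
    ∃ ρ : ℝ, 0 ≤ ρ ∧ ρ < 1 ∧ ∀ n : ℕ, ∃ D : Set (Fin n → R),
      ∑ r, iidLaw n J r * Dᶜ.indicator 1 r ≤ ρ ^ n ∧
      ∑ r, iidLaw n B r * D.indicator 1 r ≤ Real.exp (-(n * c)) := by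
  obtain ⟨ρ, hρ0, hρ1, hρ⟩ := exists_chernoff hJ hc
  have hJn : ∀ n r, 0 ≤ iidLaw n J r := fun n => prodLaw_nonneg fun _ => hJ.1
  refine ⟨ρ, hρ0, hρ1, fun n =>
    ⟨{r | Real.exp (n * c) * iidLaw n B r ≤ iidLaw n J r}, ?_, ?_⟩⟩
  · refine (sum_le_sum fun r _ => ?_).trans (hρ n)
    rcases (hJn n r).eq_or_lt with hr | hr
    · rw [← hr, zero_mul, zero_mul]
    refine mul_le_mul_of_nonneg_left ?_ hr.le
    by_cases hD : Real.exp (n * c) * iidLaw n B r ≤ iidLaw n J r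
    · rw [Set.indicator_of_notMem (by simpa using hD)]
      exact Set.indicator_nonneg (fun _ _ => zero_le_one) r
    · have hsum := sum_log_div_le hJ.1 hB hJB hr (not_le.1 hD).le
      rw [Set.indicator_of_mem (by simpa using hD), Set.indicator_of_mem (by simpa using hsum)]
  · calc ∑ r, iidLaw n B r * {r | Real.exp (n * c) * iidLaw n B r ≤ iidLaw n J r}.indicator 1 r
        ≤ ∑ r, Real.exp (-(n * c)) * iidLaw n J r := by
          refine sum_le_sum fun r _ => ?_
          rw [Real.exp_neg, inv_mul_eq_div, le_div_iff₀ (Real.exp_pos _), Set.indicator_apply]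
          split_ifs with hr
          · simpa [mul_comm] using hr
          · simpa using hJn n r
      _ = Real.exp (-(n * c)) := by
          rw [← mul_sum, (prodLaw_mem_stdSimplex fun _ => hJ).2, mul_one]

variable [Fintype X] [Fintype V]

/-- The law of two independent variables with the same marginals as `J`. -/
def prodMarginals (J : X × V → ℝ) (r : X × V) : ℝ :=
  mapLaw J Prod.fst r.1 * mapLaw J Prod.snd r.2

/-- Mutual information, in nats, of two variables with joint law `J`. -/
def mutualInfoNats (J : X × V → ℝ) : ℝ := ∑ r, J r * Real.log (J r / prodMarginals J r)

lemma mapLaw_fst (J : X × V → ℝ) (a : X) : mapLaw J Prod.fst a = ∑ v, J (a, v) := by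
  classical
  simp only [mapLaw, sum_filter, Fintype.sum_prod_type_right, sum_ite_eq', mem_univ, if_true]

lemma mapLaw_snd (J : X × V → ℝ) (v : V) : mapLaw J Prod.snd v = ∑ a, J (a, v) := by
  classical
  simp only [mapLaw, sum_filter, Fintype.sum_prod_type, sum_ite_eq', mem_univ, if_true]

lemma prodMarginals_nonneg {J : X × V → ℝ} (hJ : ∀ r, 0 ≤ J r) (r : X × V) :
    0 ≤ prodMarginals J r :=
  mul_nonneg (mapLaw_nonneg hJ _ _) (mapLaw_nonneg hJ _ _)

lemma eq_zero_of_mapLaw_eq_zero {Y : Type*} {μ : X → ℝ} (hμ : ∀ x, 0 ≤ μ x) {φ : X → Y} {x : X}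
    (h : mapLaw μ φ (φ x) = 0) : μ x = 0 :=
  (sum_eq_zero_iff_of_nonneg fun x _ => hμ x).1 h x (by simp)

lemma eq_zero_of_prodMarginals_eq_zero {J : X × V → ℝ} (hJ : ∀ r, 0 ≤ J r) {r : X × V}
    (h : prodMarginals J r = 0) : J r = 0 :=
  (mul_eq_zero.1 h).elim (eq_zero_of_mapLaw_eq_zero hJ) (eq_zero_of_mapLaw_eq_zero hJ)

lemma mutualInfoNats_nonneg {J : X × V → ℝ} (hJ : J ∈ stdSimplex ℝ (X × V)) :
    0 ≤ mutualInfoNats J := by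
  have hprod : ∑ r, prodMarginals J r = 1 := by
    simp only [prodMarginals, Fintype.sum_prod_type, ← mul_sum, (mapLaw_mem_stdSimplex hJ _).2,
      mul_one]
  have hterm : ∀ r, J r - prodMarginals J r ≤ J r * Real.log (J r / prodMarginals J r) := by
    intro r
    rcases (hJ.1 r).eq_or_lt' with hr | hr
    · simpa [hr] using prodMarginals_nonneg hJ.1 r
    have hpos : 0 < prodMarginals J r := (prodMarginals_nonneg hJ.1 r).lt_of_ne' fun h =>
      hr.ne' (eq_zero_of_prodMarginals_eq_zero hJ.1 h)
    have hlog := Real.one_sub_inv_le_log_of_pos (div_pos hr hpos)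
    calc J r - prodMarginals J r = J r * (1 - (J r / prodMarginals J r)⁻¹) := by field_simp
      _ ≤ _ := mul_le_mul_of_nonneg_left hlog hr.le
  calc (0 : ℝ) = ∑ r, (J r - prodMarginals J r) := by rw [sum_sub_distrib, hJ.2, hprod, sub_self]
    _ ≤ mutualInfoNats J := sum_le_sum fun r _ => hterm r

end Information

section CostConstraint

variable {X : Type*} [Fintype X]

lemma exists_conditioned_law {μ : X → ℝ} (hμ : ∀ x, 0 ≤ μ x) {S : Set X} {a : ℝ} (ha : 0 < a)
    (hS : a ≤ ∑ x, μ x * S.indicator 1 x) :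
    ∃ w ∈ stdSimplex ℝ X, (∀ x, w x ≠ 0 → x ∈ S) ∧ ∀ x, w x ≤ a⁻¹ * μ x := by
  have hind : ∀ x, 0 ≤ S.indicator (1 : X → ℝ) x := Set.indicator_nonneg fun _ _ => zero_le_one
  have hm := ha.trans_le hS
  refine ⟨fun x => (∑ x, μ x * S.indicator 1 x)⁻¹ * (μ x * S.indicator 1 x), ⟨fun x => ?_, ?_⟩,
    fun x hx => ?_, fun x => ?_⟩
  · exact mul_nonneg (inv_nonneg.2 hm.le) (mul_nonneg (hμ x) (hind x))
  · rw [← mul_sum, inv_mul_cancel₀ hm.ne']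
  · exact Set.mem_of_indicator_ne_zero (right_ne_zero_of_mul (right_ne_zero_of_mul hx))
  · refine mul_le_mul (inv_anti₀ ha hS) (mul_le_of_le_one_right (hμ x) ?_)
      (mul_nonneg (hμ x) (hind x)) (inv_nonneg.2 ha.le)
    exact Set.indicator_le' (fun _ _ => le_rfl) (fun _ _ => zero_le_one) x

lemma eventually_half_le_sum_iidLaw_of_lt {μ ℓ : X → ℝ} (hμ : μ ∈ stdSimplex ℝ X) {b : ℝ}
    (hb : ∑ x, μ x * ℓ x < b) :
    ∀ᶠ n : ℕ in atTop, 1 / 2 ≤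
      ∑ x : Fin n → X, iidLaw n μ x * {x | ∑ t, ℓ (x t) ≤ n * b}.indicator 1 x := by
  obtain ⟨ρ, hρ0, hρ1, hρ⟩ := exists_chernoff hμ (ℓ := -ℓ) (c := -b) (by simpa using hb)
  filter_upwards [(tendsto_pow_atTop_nhds_zero_of_lt_one hρ0 hρ1).eventually_le_const
    (show (0 : ℝ) < 1 / 2 by norm_num)] with n hn
  have hcover : ∀ x : Fin n → X, (1 : ℝ) ≤ {x | ∑ t, ℓ (x t) ≤ n * b}.indicator 1 x +
      {x | ∑ t, (-ℓ) (x t) ≤ n * -b}.indicator 1 x := by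
    intro x
    simp only [Set.indicator_apply, Set.mem_ofPred, Pi.neg_apply, sum_neg_distrib, mul_neg,
      neg_le_neg_iff, Pi.one_apply]
    rcases le_total (∑ t, ℓ (x t)) (n * b) with h | h <;> rw [if_pos h] <;> split_ifs <;> norm_num
  have htotal : 1 ≤ ∑ x : Fin n → X, iidLaw n μ x * {x | ∑ t, ℓ (x t) ≤ n * b}.indicator 1 x +
      ∑ x : Fin n → X, iidLaw n μ x * {x | ∑ t, (-ℓ) (x t) ≤ n * -b}.indicator 1 x := by
    rw [← (prodLaw_mem_stdSimplex fun _ : Fin n => hμ).2, ← sum_add_distrib]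
    refine sum_le_sum fun x _ => ?_
    rw [← mul_add]
    exact le_mul_of_one_le_right (prodLaw_nonneg (fun _ => hμ.1) x) (hcover x)
  linarith [hρ n]

lemma sum_iidLaw_eq_one_of_forall_le {μ ℓ : X → ℝ} (hμ : ∑ x, μ x = 1) {b : ℝ}
    (hb : ∀ x, μ x ≠ 0 → ℓ x ≤ b) (n : ℕ) :
    ∑ x : Fin n → X, iidLaw n μ x * {x | ∑ t, ℓ (x t) ≤ n * b}.indicator 1 x = 1 := by
  calc ∑ x : Fin n → X, iidLaw n μ x * {x | ∑ t, ℓ (x t) ≤ n * b}.indicator 1 x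
      = ∑ x : Fin n → X, iidLaw n μ x := by
        refine sum_congr rfl fun x _ => ?_
        by_cases hx : iidLaw n μ x = 0
        · rw [hx, zero_mul]
        have hcost : ∑ t, ℓ (x t) ≤ n * b := by
          simpa using sum_le_card_nsmul univ (fun t => ℓ (x t)) b fun t _ =>
            hb _ (prod_ne_zero_iff.1 hx t (mem_univ t))
        rw [Set.indicator_of_mem (by simpa using hcost), Pi.one_apply, mul_one]
    _ = 1 := by rw [sum_prodLaw, prod_congr rfl fun _ _ => hμ, prod_const_one]

lemma eventually_exists_codeword_law {μ ℓ : X → ℝ} (hμ : μ ∈ stdSimplex ℝ X) {b : ℝ}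
    (hb : ∑ x, μ x * ℓ x < b ∨ ∀ x, μ x ≠ 0 → ℓ x ≤ b) :
    ∀ᶠ n : ℕ in atTop, ∃ w ∈ stdSimplex ℝ (Fin n → X),
      (∀ x, w x ≠ 0 → ∑ t, ℓ (x t) ≤ n * b) ∧ ∀ x, w x ≤ 2 * iidLaw n μ x := by
  have hhalf : ∀ᶠ n : ℕ in atTop, 1 / 2 ≤
      ∑ x : Fin n → X, iidLaw n μ x * {x | ∑ t, ℓ (x t) ≤ n * b}.indicator 1 x := by
    rcases hb with hb | hb
    · exact eventually_half_le_sum_iidLaw_of_lt hμ hb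
    · refine Eventually.of_forall fun n => ?_
      rw [sum_iidLaw_eq_one_of_forall_le hμ.2 hb]
      norm_num
  filter_upwards [hhalf] with n hn
  simpa using exists_conditioned_law (prodLaw_nonneg fun _ => hμ.1) one_half_pos hn

end CostConstraint

section Entropy

variable {X V : Type*} [Fintype X] [Fintype V]

lemma mutualInfoNats_eq_sum_negMulLog {J : X × V → ℝ} (hJ : ∀ r, 0 ≤ J r) :
    mutualInfoNats J = ∑ a, Real.negMulLog (mapLaw J Prod.fst a) +
      ∑ v, Real.negMulLog (mapLaw J Prod.snd v) - ∑ r, Real.negMulLog (J r) := by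
  have hterm : ∀ r, J r * Real.log (J r / prodMarginals J r) = J r * Real.log (J r) -
      J r * Real.log (mapLaw J Prod.fst r.1) - J r * Real.log (mapLaw J Prod.snd r.2) := by
    intro r
    rcases eq_or_ne (J r) 0 with hr | hr
    · simp [hr]
    rw [prodMarginals, Real.log_div hr (mul_ne_zero (hr ∘ eq_zero_of_mapLaw_eq_zero hJ)
      (hr ∘ eq_zero_of_mapLaw_eq_zero hJ)), Real.log_mul (hr ∘ eq_zero_of_mapLaw_eq_zero hJ)
      (hr ∘ eq_zero_of_mapLaw_eq_zero hJ)]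
    ring
  simp only [mutualInfoNats, hterm, sum_sub_distrib, Real.negMulLog, neg_mul, sum_neg_distrib]
  rw [sum_mapLaw_mul J Prod.fst fun a => Real.log (mapLaw J Prod.fst a),
    sum_mapLaw_mul J Prod.snd fun v => Real.log (mapLaw J Prod.snd v)]
  ring

/-- The joint law of the input and the observation after the observation is erased (`none`) with
probability `ε`, independently of everything else. -/
def eraseLaw (ε : ℝ) (J : X × V → ℝ) : X × Option V → ℝ
  | (a, none) => ε * mapLaw J Prod.fst a
  | (a, some v) => (1 - ε) * J (a, v)

lemma mapLaw_eraseLaw_fst (ε : ℝ) (J : X × V → ℝ) :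
    mapLaw (eraseLaw ε J) Prod.fst = mapLaw J Prod.fst := by
  ext a
  simp only [mapLaw_fst, eraseLaw, Fintype.sum_option, ← mul_sum]
  ring

lemma mapLaw_eraseLaw_snd_some (ε : ℝ) (J : X × V → ℝ) (v : V) :
    mapLaw (eraseLaw ε J) Prod.snd (some v) = (1 - ε) * mapLaw J Prod.snd v := by
  simp only [mapLaw_snd, eraseLaw, mul_sum]

lemma mapLaw_eraseLaw_snd_none (ε : ℝ) {J : X × V → ℝ} (hJ : ∑ r, J r = 1) :
    mapLaw (eraseLaw ε J) Prod.snd none = ε := by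
  simp only [mapLaw_snd, eraseLaw, mapLaw_fst, ← mul_sum, ← Fintype.sum_prod_type', hJ, mul_one]

lemma mutualInfoNats_eraseLaw (ε : ℝ) {J : X × V → ℝ} (hJ : ∑ r, J r = 1) :
    mutualInfoNats (eraseLaw ε J) = (1 - ε) * mutualInfoNats J := by
  have hnone : ∀ a, eraseLaw ε J (a, none) *
      Real.log (eraseLaw ε J (a, none) / prodMarginals (eraseLaw ε J) (a, none)) = 0 := by
    intro a
    rw [prodMarginals, mapLaw_eraseLaw_fst, mapLaw_eraseLaw_snd_none ε hJ, eraseLaw,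
      mul_comm (mapLaw J Prod.fst a), Real.log_div_self, mul_zero]
  have hsome : ∀ a v, eraseLaw ε J (a, some v) *
      Real.log (eraseLaw ε J (a, some v) / prodMarginals (eraseLaw ε J) (a, some v)) =
      (1 - ε) * (J (a, v) * Real.log (J (a, v) / prodMarginals J (a, v))) := by
    intro a v
    rcases eq_or_ne (1 - ε) 0 with hε | hε
    · simp only [eraseLaw, hε, zero_mul]
    rw [prodMarginals, mapLaw_eraseLaw_fst, mapLaw_eraseLaw_snd_some, eraseLaw, mul_left_comm,
      mul_div_mul_left _ _ hε, mul_assoc, prodMarginals]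
  simp only [mutualInfoNats, Fintype.sum_prod_type, Fintype.sum_option, hnone, hsome, zero_add,
    mul_sum]

/-- The Bernoulli law with parameter `p`. -/
def bern (p : ℝ) (a : Bool) : ℝ := if a then p else 1 - p

lemma bern_mem_stdSimplex {p : ℝ} (h0 : 0 ≤ p) (h1 : p ≤ 1) : bern p ∈ stdSimplex ℝ Bool :=
  ⟨Bool.forall_bool.2 ⟨sub_nonneg.2 h1, h0⟩, by simp [bern]⟩

lemma sum_bern (p : ℝ) : ∑ a, bern p a = 1 := by simp [bern]

lemma sum_negMulLog_bern (p : ℝ) : ∑ a, Real.negMulLog (bern p a) = Real.binEntropy p := by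
  simp [bern, Real.binEntropy_eq_negMulLog_add_negMulLog_one_sub]

/-- Here `c a` is the probability that a binary channel with input `a` outputs `true`. -/
lemma mutualInfoNats_binary_channel {J : Bool × Bool → ℝ} (hJ : ∀ r, 0 ≤ J r) {r : ℝ}
    {c : Bool → ℝ} (hrc : ∀ a b, J (a, b) = bern r a * bern (c a) b) :
    mutualInfoNats J =
      Real.binEntropy (∑ a, bern r a * c a) - ∑ a, bern r a * Real.binEntropy (c a) := by
  have hfst : mapLaw J Prod.fst = bern r := by
    ext a
    rw [mapLaw_fst]
    simp only [hrc, ← mul_sum, sum_bern, mul_one]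
  have hsnd : mapLaw J Prod.snd = bern (∑ a, bern r a * c a) := by
    ext b
    rw [mapLaw_snd]
    cases b <;> simp [hrc, bern]
    ring
  have hchain : ∀ a, ∑ b, Real.negMulLog (J (a, b)) =
      Real.negMulLog (bern r a) + bern r a * Real.binEntropy (c a) := by
    intro a
    simp only [hrc, Real.negMulLog_mul, sum_add_distrib, ← sum_mul, ← mul_sum, sum_bern, one_mul,
      sum_negMulLog_bern]
  rw [mutualInfoNats_eq_sum_negMulLog hJ, hfst, hsnd, Fintype.sum_prod_type]
  simp only [hchain, sum_add_distrib, sum_negMulLog_bern]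
  ring

lemma mutualInfo_mul_log_two (J : Bool × Bool → ℝ) :
    mutualInfo (fun a b => J (a, b)) * Real.log 2 = mutualInfoNats J := by
  have hlog : Real.log 2 ≠ 0 := (Real.log_pos one_lt_two).ne'
  simp only [mutualInfo, mutualInfoNats, sum_mul, Fintype.sum_prod_type, prodMarginals, mapLaw_fst,
    mapLaw_snd, Real.logb, mul_assoc, div_mul_cancel₀ _ hlog]

end Entropy

section RandomCoding

variable {ι κ α X Y V : Type*} [Fintype ι] [Fintype κ] [Fintype α] {n : ℕ}

lemma prodLaw_le_pow_mul_prodLaw {w v : κ → X → ℝ} {c : ℝ} (hw : ∀ k x, 0 ≤ w k x)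
    (hwv : ∀ k x, w k x ≤ c * v k x) (x : κ → X) :
    prodLaw w x ≤ c ^ Fintype.card κ * prodLaw v x :=
  (prod_le_prod (fun k _ => hw k _) fun k _ => hwv k (x k)).trans_eq <| by
    rw [prod_mul_distrib, prod_const, card_univ, prodLaw]

variable [Fintype X] [Fintype Y] [Fintype V] [DecidableEq ι] [DecidableEq κ] [DecidableEq α]

lemma sum_prodLaw_iidLaw_mul (μ : κ → X → ℝ) (W : (κ → X) → Y → ℝ)
    (F : (Fin n → (κ → X) × Y) → ℝ) :
    ∑ x : κ → Fin n → X, prodLaw (fun k => iidLaw n (μ k)) x *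
      ∑ y, prodLaw (fun t => W fun k => x k t) y * F (fun t => (fun k => x k t, y t)) =
    ∑ s, iidLaw n (jointLaw (prodLaw μ) W) s * F s := by
  rw [← Equiv.sum_comp (Equiv.arrowProdEquivProdArrow (Fin n) (fun _ => κ → X)
    (fun _ => Y)).symm, Fintype.sum_prod_type, ← Equiv.sum_comp (Equiv.piComm _)]
  refine sum_congr rfl fun x _ => ?_
  rw [mul_sum]
  refine sum_congr rfl fun y _ => ?_
  rw [← mul_assoc]
  congr 1
  simp only [prodLaw]
  rw [Finset.prod_comm, ← prod_mul_distrib]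
  rfl

/-- If every codeword law is at most `c` times an independent and identically distributed one, then
replacing the `|κ|` codewords that matter by independent letters costs a factor `c ^ |κ|`. -/
lemma sum_codebooks_le {μ : α → X → ℝ} {w : α → (Fin n → X) → ℝ} {c : ℝ}
    (hw : ∀ a, w a ∈ stdSimplex ℝ (Fin n → X)) (hwμ : ∀ a x, w a x ≤ c * iidLaw n (μ a) x)
    {σ : κ → α} (hσ : σ.Injective) {W : (κ → X) → Y → ℝ} (hW : ∀ x y, 0 ≤ W x y)
    (φ : (κ → X) × Y → V) {F : (Fin n → V) → ℝ} (hF : ∀ r, 0 ≤ F r) :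
    ∑ f, prodLaw w f * ∑ y, prodLaw (fun t => W fun k => f (σ k) t) y *
      F (fun t => φ (fun k => f (σ k) t, y t)) ≤
    c ^ Fintype.card κ *
      ∑ r, iidLaw n (mapLaw (jointLaw (prodLaw fun k => μ (σ k)) W) φ) r * F r := by
  calc ∑ f, prodLaw w f * ∑ y, prodLaw (fun t => W fun k => f (σ k) t) y *
        F (fun t => φ (fun k => f (σ k) t, y t))
      = ∑ x, prodLaw (fun k => w (σ k)) x * ∑ y, prodLaw (fun t => W fun k => x k t) y *
        F (fun t => φ (fun k => x k t, y t)) := by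
        rw [← mapLaw_prodLaw_comp (fun a => (hw a).2) hσ, sum_mapLaw_mul]
    _ ≤ ∑ x, (c ^ Fintype.card κ * prodLaw (fun k => iidLaw n (μ (σ k))) x) *
        ∑ y, prodLaw (fun t => W fun k => x k t) y * F (fun t => φ (fun k => x k t, y t)) := by
        refine sum_le_sum fun x _ => mul_le_mul_of_nonneg_right
          (prodLaw_le_pow_mul_prodLaw (fun k => (hw (σ k)).1) (fun k => hwμ (σ k)) x) ?_
        exact sum_nonneg fun y _ => mul_nonneg (prodLaw_nonneg (fun t => hW _) y) (hF _)
    _ = c ^ Fintype.card κ *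
        ∑ s, iidLaw n (jointLaw (prodLaw fun k => μ (σ k)) W) s * F (fun t => φ (s t)) := by
        rw [← sum_prodLaw_iidLaw_mul, mul_sum]
        exact sum_congr rfl fun x _ => mul_assoc _ _ _
    _ = c ^ Fintype.card κ *
        ∑ r, iidLaw n (mapLaw (jointLaw (prodLaw fun k => μ (σ k)) W) φ) r * F r := by
        rw [iidLaw, iidLaw, ← mapLaw_prodLaw, sum_mapLaw_mul]

/-- The joint law of the input of bit-pipe `i` and of the observation `g`, when the inputs of the
vector channel `W` are independent with laws `μ`. -/
def pipeLaw (μ : ι → X → ℝ) (W : (ι → X) → Y → ℝ) (g : (ι → X) × Y → V) (i : ι) : X × V → ℝ :=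
  mapLaw (jointLaw (prodLaw μ) W) fun s => (s.1 i, g s)

variable {μ : ι → X → ℝ} {W : (ι → X) → Y → ℝ}

lemma pipeLaw_mem_stdSimplex (hμ : ∀ i, μ i ∈ stdSimplex ℝ X) (hW : ∀ x, W x ∈ stdSimplex ℝ Y)
    (g : (ι → X) × Y → V) (i : ι) : pipeLaw μ W g i ∈ stdSimplex ℝ (X × V) :=
  mapLaw_mem_stdSimplex (jointLaw_mem_stdSimplex (prodLaw_mem_stdSimplex hμ) hW) _

lemma mapLaw_pipeLaw_fst (hμ : ∀ i, ∑ a, μ i a = 1) (hW : ∀ x, ∑ y, W x y = 1)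
    (g : (ι → X) × Y → V) (i : ι) : mapLaw (pipeLaw μ W g i) Prod.fst = μ i := by
  calc mapLaw (pipeLaw μ W g i) Prod.fst
      = mapLaw (mapLaw (jointLaw (prodLaw μ) W) Prod.fst) (fun x => x i) := by
        rw [pipeLaw, mapLaw_comp, mapLaw_comp]
        rfl
    _ = μ i := by rw [mapLaw_jointLaw_fst _ hW, mapLaw_prodLaw_eval hμ]

lemma mapLaw_pipeLaw_snd (μ : ι → X → ℝ) (W : (ι → X) → Y → ℝ) (g : (ι → X) × Y → V) (i : ι) :
    mapLaw (pipeLaw μ W g i) Prod.snd = mapLaw (jointLaw (prodLaw μ) W) g :=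
  mapLaw_comp _ _ _

omit [Fintype V] in
lemma mapLaw_jointLaw_option (ν : X → ℝ) (μ : ι → X → ℝ) (W : (ι → X) → Y → ℝ)
    (g : (ι → X) × Y → V) :
    mapLaw (jointLaw (prodLaw fun k : Option ι => k.elim ν μ) fun x => W fun j => x (some j))
      (fun s => (s.1 none, g (fun j => s.1 (some j), s.2))) =
    fun r => ν r.1 * mapLaw (jointLaw (prodLaw μ) W) g r.2 := by
  classical
  ext ⟨a, v⟩
  simp only [mapLaw, sum_filter, Fintype.sum_prod_type]
  rw [← Equiv.sum_comp (Equiv.piOptionEquivProd (β := fun _ => X)).symm, Fintype.sum_prod_type]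
  simp [jointLaw, prodLaw, Fintype.prod_option, mul_sum, ite_and, sum_ite_irrel, mul_assoc]

/-- The probability that the sequence `z`, paired with the observations of `g` when `x` is sent
over the channel `W`, lies in `S`. -/
def pairProb (W : (ι → X) → Y → ℝ) (g : (ι → X) × Y → V) (S : Set (Fin n → X × V))
    (x : Fin n → ι → X) (z : Fin n → X) : ℝ :=
  ∑ y, prodLaw (fun t => W (x t)) y * S.indicator 1 fun t => (z t, g (x t, y t))

/-- The decoder that looks for a message whose codeword, paired with the observation, passes the
test `D`. The choice is arbitrary when there is no such message or more than one. -/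
def testDecoder {M : Type*} [Nonempty M] (D : Set (Fin n → X × V)) (enc : M → Fin n → X)
    (v : Fin n → V) : M :=
  Classical.epsilon fun k => (fun t => (enc k t, v t)) ∈ D

omit [Fintype X] [Fintype V] in
lemma testDecoder_error_le {M : Type*} [Nonempty M] [Fintype M] [DecidableEq M]
    (D : Set (Fin n → X × V)) (enc : M → Fin n → X) (v : Fin n → V) (m : M) :
    (if testDecoder D enc v = m then 0 else 1 : ℝ) ≤
      Dᶜ.indicator 1 (fun t => (enc m t, v t)) +
        ∑ k ∈ univ.erase m, D.indicator 1 fun t => (enc k t, v t) := by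
  have hnonneg : ∀ (S : Set (Fin n → X × V)) r, (0 : ℝ) ≤ S.indicator 1 r :=
    fun S => Set.indicator_nonneg fun _ _ => zero_le_one
  split_ifs with hm
  · exact add_nonneg (hnonneg _ _) (sum_nonneg fun k _ => hnonneg _ _)
  by_cases hD : (fun t => (enc m t, v t)) ∈ D
  · have hpass : (fun t => (enc (testDecoder D enc v) t, v t)) ∈ D :=
      Classical.epsilon_spec (p := fun k => (fun t => (enc k t, v t)) ∈ D) ⟨m, hD⟩
    calc (1 : ℝ) = D.indicator 1 fun t => (enc (testDecoder D enc v) t, v t) :=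
          (Set.indicator_of_mem hpass 1).symm
      _ ≤ ∑ k ∈ univ.erase m, D.indicator 1 fun t => (enc k t, v t) :=
          single_le_sum
            (f := fun k => D.indicator (1 : (Fin n → X × V) → ℝ) fun t => (enc k t, v t))
            (fun k _ => hnonneg _ _) (mem_erase.2 ⟨hm, mem_univ _⟩)
      _ ≤ _ := le_add_of_nonneg_left (hnonneg _ _)
  · rw [Set.indicator_of_mem (Set.mem_compl hD), Pi.one_apply]
    exact le_add_of_nonneg_right (sum_nonneg fun k _ => hnonneg _ _)

variable {M : ι → Type*} [∀ i, Fintype (M i)] [∀ i, DecidableEq (M i)]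

/-- The sequence of channel inputs for the message tuple `m`. -/
def sentBlock (enc : ∀ i, M i → Fin n → X) (m : ∀ i, M i) (t : Fin n) (i : ι) : X := enc i (m i) t

/-- The probability that some message of the tuple `m` is decoded wrongly, when decoder `i` sees the
observations of `g i`. -/
def wrongProb (W : (ι → X) → Y → ℝ) (g : ι → (ι → X) × Y → V) (enc : ∀ i, M i → Fin n → X)
    (dec : ∀ i, (Fin n → V) → M i) (m : ∀ i, M i) : ℝ :=
  ∑ y, prodLaw (fun t => W (sentBlock enc m t)) y *
    if ∀ i, dec i (fun t => g i (sentBlock enc m t, y t)) = m i then 0 else 1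

omit [Fintype X] [Fintype V] [DecidableEq ι] in
lemma wrongProb_testDecoder_le [∀ i, Nonempty (M i)] (hW : ∀ x y, 0 ≤ W x y)
    (g : ι → (ι → X) × Y → V) (enc : ∀ i, M i → Fin n → X) (D : ι → Set (Fin n → X × V))
    (m : ∀ i, M i) :
    wrongProb W g enc (fun i => testDecoder (D i) (enc i)) m ≤
      ∑ i, (pairProb W (g i) (D i)ᶜ (sentBlock enc m) (enc i (m i)) +
        ∑ k ∈ univ.erase (m i), pairProb W (g i) (D i) (sentBlock enc m) (enc i k)) := by
  have hunion : ∀ v : ι → Fin n → V,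
      (if ∀ i, testDecoder (D i) (enc i) (v i) = m i then 0 else 1 : ℝ) ≤
        ∑ i, if testDecoder (D i) (enc i) (v i) = m i then 0 else 1 := by
    intro v
    have hnonneg : ∀ i ∈ (univ : Finset ι),
        (0 : ℝ) ≤ if testDecoder (D i) (enc i) (v i) = m i then 0 else 1 :=
      fun i _ => by split_ifs <;> norm_num
    split_ifs with h
    · exact sum_nonneg hnonneg
    · obtain ⟨i, hi⟩ := not_forall.1 h
      simpa [hi] using single_le_sum hnonneg (mem_univ i)
  calc wrongProb W g enc (fun i => testDecoder (D i) (enc i)) m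
      ≤ ∑ y, prodLaw (fun t => W (sentBlock enc m t)) y * ∑ i,
        ((D i)ᶜ.indicator 1 (fun t => (enc i (m i) t, g i (sentBlock enc m t, y t))) +
          ∑ k ∈ univ.erase (m i),
            (D i).indicator 1 fun t => (enc i k t, g i (sentBlock enc m t, y t))) :=
        sum_le_sum fun y _ => mul_le_mul_of_nonneg_left
          ((hunion _).trans <| sum_le_sum fun i _ => testDecoder_error_le (D i) (enc i) _ (m i))
          (prodLaw_nonneg (fun _ => hW _) y)
    _ = _ := by
        simp only [pairProb, mul_sum, mul_add, sum_add_distrib]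
        rw [sum_comm]
        congr 1
        rw [sum_comm]
        exact sum_congr rfl fun i _ => sum_comm

section Expectation

variable {w : ι → (Fin n → X) → ℝ} {c : ℝ}

lemma sum_codebooks_miss_le (hW : ∀ x y, 0 ≤ W x y) (hw : ∀ i, w i ∈ stdSimplex ℝ (Fin n → X))
    (hwμ : ∀ i x, w i x ≤ c * iidLaw n (μ i) x) (g : (ι → X) × Y → V) (i : ι)
    (m : ∀ i, M i) (D : Set (Fin n → X × V)) :
    ∑ f : (Σ i, M i) → Fin n → X, prodLaw (fun a => w a.1) f *
      pairProb W g Dᶜ (sentBlock (fun i k => f ⟨i, k⟩) m) (f ⟨i, m i⟩) ≤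
    c ^ Fintype.card ι * ∑ r, iidLaw n (pipeLaw μ W g i) r * Dᶜ.indicator 1 r :=
  sum_codebooks_le (μ := fun a : Σ i, M i => μ a.1) (fun a => hw a.1) (fun a => hwμ a.1)
    (σ := fun j => ⟨j, m j⟩) (fun _ _ h => congrArg Sigma.fst h) hW
    (fun s => (s.1 i, g s)) (Set.indicator_nonneg fun _ _ => zero_le_one)

lemma sum_codebooks_falseAlarm_le (hμ : ∀ i, ∑ a, μ i a = 1) (hW : ∀ x, W x ∈ stdSimplex ℝ Y)
    (hw : ∀ i, w i ∈ stdSimplex ℝ (Fin n → X)) (hwμ : ∀ i x, w i x ≤ c * iidLaw n (μ i) x)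
    (g : (ι → X) × Y → V) (i : ι) (m : ∀ i, M i) {k : M i} (hk : k ≠ m i)
    (D : Set (Fin n → X × V)) :
    ∑ f : (Σ i, M i) → Fin n → X, prodLaw (fun a => w a.1) f *
      pairProb W g D (sentBlock (fun i k => f ⟨i, k⟩) m) (f ⟨i, k⟩) ≤
    c ^ (Fintype.card ι + 1) *
      ∑ r, iidLaw n (prodMarginals (pipeLaw μ W g i)) r * D.indicator 1 r := by
  let σ : Option ι → Σ i, M i := fun j => j.elim ⟨i, k⟩ fun j => ⟨j, m j⟩
  have hσ : σ.Injective := by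
    rintro (_ | a) (_ | b) hab
    · rfl
    · obtain ⟨rfl, h⟩ := Sigma.mk.inj_iff.1 hab
      exact absurd (eq_of_heq h) hk
    · obtain ⟨rfl, h⟩ := Sigma.mk.inj_iff.1 hab
      exact absurd (eq_of_heq h).symm hk
    · exact congrArg some (congrArg Sigma.fst hab)
  have hlaw : mapLaw (jointLaw (prodLaw fun j => μ (σ j).1) fun x => W fun j => x (some j))
      (fun s => (s.1 none, g (fun j => s.1 (some j), s.2))) =
      prodMarginals (pipeLaw μ W g i) := by
    ext r
    rw [prodMarginals, mapLaw_pipeLaw_fst hμ fun x => (hW x).2, mapLaw_pipeLaw_snd,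
      ← congrFun (mapLaw_jointLaw_option (μ i) μ W g) r]
    congr! 4 with j
    cases j <;> rfl
  have hcodebooks := sum_codebooks_le (n := n) (c := c) (μ := fun a : Σ i, M i => μ a.1)
    (w := fun a => w a.1) (fun a => hw a.1) (fun a => hwμ a.1) hσ
    (W := fun x => W fun j => x (some j)) (fun x y => (hW _).1 y)
    (fun s => (s.1 none, g (fun j => s.1 (some j), s.2))) (F := D.indicator 1)
    (Set.indicator_nonneg fun _ _ => zero_le_one)
  rw [hlaw, Fintype.card_option] at hcodebooks
  exact hcodebooks

lemma sum_codebooks_wrongProb_le [∀ i, Nonempty (M i)] (hμ : ∀ i, ∑ a, μ i a = 1)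
    (hW : ∀ x, W x ∈ stdSimplex ℝ Y) (hc : 0 ≤ c) (hw : ∀ i, w i ∈ stdSimplex ℝ (Fin n → X))
    (hwμ : ∀ i x, w i x ≤ c * iidLaw n (μ i) x) (g : ι → (ι → X) × Y → V)
    {D : ι → Set (Fin n → X × V)} {a b : ι → ℝ}
    (ha : ∀ i, ∑ r, iidLaw n (pipeLaw μ W (g i) i) r * (D i)ᶜ.indicator 1 r ≤ a i)
    (hb : ∀ i, ∑ r, iidLaw n (prodMarginals (pipeLaw μ W (g i) i)) r * (D i).indicator 1 r ≤ b i)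
    (m : ∀ i, M i) :
    ∑ f : (Σ i, M i) → Fin n → X, prodLaw (fun a => w a.1) f *
      wrongProb W g (fun i k => f ⟨i, k⟩) (fun i => testDecoder (D i) fun k => f ⟨i, k⟩) m ≤
    ∑ i, (c ^ Fintype.card ι * a i +
      (Fintype.card (M i) - 1) * (c ^ (Fintype.card ι + 1) * b i)) := by
  have hW0 : ∀ x y, 0 ≤ W x y := fun x => (hW x).1
  calc ∑ f : (Σ i, M i) → Fin n → X, prodLaw (fun a => w a.1) f *
        wrongProb W g (fun i k => f ⟨i, k⟩) (fun i => testDecoder (D i) fun k => f ⟨i, k⟩) m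
      ≤ ∑ f : (Σ i, M i) → Fin n → X, prodLaw (fun a => w a.1) f *
        ∑ i, (pairProb W (g i) (D i)ᶜ (sentBlock (fun i k => f ⟨i, k⟩) m) (f ⟨i, m i⟩) +
          ∑ k ∈ univ.erase (m i),
            pairProb W (g i) (D i) (sentBlock (fun i k => f ⟨i, k⟩) m) (f ⟨i, k⟩)) :=
        sum_le_sum fun f _ => mul_le_mul_of_nonneg_left
          (wrongProb_testDecoder_le hW0 g (fun i k => f ⟨i, k⟩) D m)
          (prodLaw_nonneg (fun a => (hw a.1).1) f)
    _ = ∑ i, (∑ f : (Σ i, M i) → Fin n → X, prodLaw (fun a => w a.1) f *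
          pairProb W (g i) (D i)ᶜ (sentBlock (fun i k => f ⟨i, k⟩) m) (f ⟨i, m i⟩) +
        ∑ k ∈ univ.erase (m i), ∑ f : (Σ i, M i) → Fin n → X, prodLaw (fun a => w a.1) f *
          pairProb W (g i) (D i) (sentBlock (fun i k => f ⟨i, k⟩) m) (f ⟨i, k⟩)) := by
        simp only [mul_sum, mul_add, sum_add_distrib]
        rw [sum_comm]
        congr 1
        rw [sum_comm]
        exact sum_congr rfl fun i _ => sum_comm
    _ ≤ _ := by
        refine sum_le_sum fun i _ => add_le_add ?_ ?_
        · exact (sum_codebooks_miss_le hW0 hw hwμ (g i) i m (D i)).trans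
            (mul_le_mul_of_nonneg_left (ha i) (pow_nonneg hc _))
        · refine (sum_le_card_nsmul _ _ _ fun k hk =>
            (sum_codebooks_falseAlarm_le hμ hW hw hwμ (g i) i m (ne_of_mem_erase hk) (D i)).trans
              (mul_le_mul_of_nonneg_left (hb i) (pow_nonneg hc _))).trans_eq ?_
          rw [card_erase_of_mem (mem_univ _), card_univ, nsmul_eq_mul,
            Nat.cast_sub Fintype.card_pos, Nat.cast_one]

end Expectation

omit [DecidableEq ι] in
lemma tendsto_sum_pow_add_pow {ρ d : ι → ℝ} (hρ : ∀ i, 0 ≤ ρ i ∧ ρ i < 1) (hd : ∀ i, 0 < d i)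
    (a b : ℝ) :
    Tendsto (fun n : ℕ => ∑ i, (a * ρ i ^ n + b * Real.exp (-(n * d i)))) atTop (nhds 0) := by
  have hterm : ∀ i ∈ (univ : Finset ι), Tendsto
      (fun n : ℕ => a * ρ i ^ n + b * Real.exp (-(n * d i))) atTop (nhds 0) := by
    intro i _
    simp only [← mul_neg, Real.exp_nat_mul]
    simpa using ((tendsto_pow_atTop_nhds_zero_of_lt_one (hρ i).1 (hρ i).2).const_mul a).add
      ((tendsto_pow_atTop_nhds_zero_of_lt_one (Real.exp_pos _).le
        (Real.exp_lt_one_iff.2 (neg_neg_of_pos (hd i)))).const_mul b)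
  simpa using tendsto_finsetSum univ hterm

theorem eventually_exists_codebook (hμ : ∀ i, μ i ∈ stdSimplex ℝ X)
    (hW : ∀ x, W x ∈ stdSimplex ℝ Y) (g : ι → (ι → X) × Y → V) {ℓ : X → ℝ} {b R : ι → ℝ}
    (hb : ∀ i, ∑ x, μ i x * ℓ x < b i ∨ ∀ x, μ i x ≠ 0 → ℓ x ≤ b i)
    (hR : ∀ i, R i < mutualInfoNats (pipeLaw μ W (g i) i)) {δ : ℝ} (hδ : 0 < δ) :
    ∀ᶠ n : ℕ in atTop, ∀ M : ι → ℕ, (∀ i, 0 < M i) → (∀ i, (M i : ℝ) - 1 ≤ Real.exp (n * R i)) →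
      ∃ (enc : ∀ i, Fin (M i) → Fin n → X) (dec : ∀ i, (Fin n → V) → Fin (M i)),
        (∀ i m, ∑ t, ℓ (enc i m t) ≤ n * b i) ∧
        ∑ m, wrongProb W g enc dec m ≤ (∏ i, M i) * δ := by
  have hJ : ∀ i, pipeLaw μ W (g i) i ∈ stdSimplex ℝ (X × V) :=
    fun i => pipeLaw_mem_stdSimplex hμ hW (g i) i
  choose c hRc hcI using fun i => exists_between (hR i)
  have htest := fun i => exists_threshold_test (hJ i) (prodMarginals_nonneg (hJ i).1)
    (fun r => eq_zero_of_prodMarginals_eq_zero (hJ i).1) (hcI i)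
  choose ρ hρ0 hρ1 D hmiss hfalse using htest
  have htail := tendsto_sum_pow_add_pow (fun i => ⟨hρ0 i, hρ1 i⟩)
    (fun i => sub_pos.2 (hRc i))
    (2 ^ Fintype.card ι) (2 ^ (Fintype.card ι + 1))
  filter_upwards [eventually_all.2 fun i => eventually_exists_codeword_law (hμ i) (hb i),
    htail.eventually_le_const hδ] with n hn hsmall M hM hMR
  choose w hw hwcost hwμ using hn
  have : ∀ i, Nonempty (Fin (M i)) := fun i => ⟨⟨0, hM i⟩⟩
  have hmean : ∑ f : (Σ i, Fin (M i)) → Fin n → X, prodLaw (fun a => w a.1) f *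
      ∑ m, wrongProb W g (fun i k => f ⟨i, k⟩) (fun i => testDecoder (D i n) fun k => f ⟨i, k⟩) m ≤
      (∏ i, M i) * δ := by
    simp only [mul_sum]
    rw [sum_comm]
    refine (sum_le_card_nsmul _ _ _ fun m _ => (sum_codebooks_wrongProb_le (fun i => (hμ i).2) hW
      zero_le_two hw hwμ g (fun i => hmiss i n) (fun i => hfalse i n) m).trans
      (le_trans (sum_le_sum fun i _ => ?_) hsmall)).trans_eq ?_
    · rw [mul_left_comm, Fintype.card_fin]
      refine add_le_add le_rfl (mul_le_mul_of_nonneg_left ?_ (by positivity))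
      refine (mul_le_mul_of_nonneg_right (hMR i) (Real.exp_pos _).le).trans_eq ?_
      rw [← Real.exp_add]
      ring_nf
    · rw [card_univ, Fintype.card_pi, nsmul_eq_mul]
      simp only [Fintype.card_fin]
  obtain ⟨f, hf, hfδ⟩ := exists_ne_zero_le_of_sum_mul_le
    (prodLaw_mem_stdSimplex fun a : Σ i, Fin (M i) => hw a.1) hmean
  exact ⟨_, _, fun i m => hwcost i _ (prod_ne_zero_iff.1 hf ⟨i, m⟩ (mem_univ _)), hfδ⟩

end RandomCoding

section Noise

variable {A β γ : ℝ}

lemma integrable_exp_neg_sq_div_two :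
    MeasureTheory.Integrable fun u : ℝ => Real.exp (-u ^ 2 / 2) :=
  (integrable_exp_neg_mul_sq one_half_pos).congr <| .of_forall fun u =>
    congrArg Real.exp (by ring)

lemma gaussQ_strictAnti : StrictAnti gaussQ := by
  intro a b hab
  have hsplit : (∫ u in Set.Ioi a, Real.exp (-u ^ 2 / 2)) =
      (∫ u in a..b, Real.exp (-u ^ 2 / 2)) + ∫ u in Set.Ioi b, Real.exp (-u ^ 2 / 2) := by
    rw [intervalIntegral.integral_interval_add_Ioi] <;>
      exact integrable_exp_neg_sq_div_two.integrableOn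
  have hpos : 0 < ∫ u in a..b, Real.exp (-u ^ 2 / 2) :=
    intervalIntegral.intervalIntegral_pos_of_pos
      integrable_exp_neg_sq_div_two.intervalIntegrable (fun u => Real.exp_pos _) hab
  exact mul_lt_mul_of_pos_left (hsplit ▸ lt_add_of_pos_left _ hpos) (by positivity)

lemma gaussQ_zero : gaussQ 0 = 1 / 2 := by
  have hintegral : (∫ u in Set.Ioi (0 : ℝ), Real.exp (-u ^ 2 / 2)) = √(2 * Real.pi) / 2 := by
    convert! integral_gaussian_Ioi (1 / 2) using 3 <;> ring_nf
  rw [gaussQ, hintegral]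
  have : √(2 * Real.pi) ≠ 0 := by positivity
  field_simp

lemma epsBar_lt_one {β : ℝ} (hβ : 0 < β) : epsBar β < 1 := by
  have hlt := gaussQ_zero ▸ gaussQ_strictAnti hβ
  rw [epsBar]
  linarith

lemma noiseProb_denom_pos (hA : 0 < A) (hβ : 0 < β) (hγ : 0 < γ) :
    0 < gaussQ ((-(⌈γ * A⌉ : ℝ) - γ * β) / γ) -
      gaussQ (((⌈γ * (A + 2 * β)⌉ : ℝ) - γ * β) / γ) := by
  have hA' : 0 < γ * A := by positivity
  have hβ' : 0 < γ * (A + 2 * β) := by positivity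
  have hlo := Int.le_ceil (γ * A)
  have hhi := Int.le_ceil (γ * (A + 2 * β))
  refine sub_pos.2 (gaussQ_strictAnti ?_)
  rw [div_lt_div_iff_of_pos_right hγ]
  linarith

lemma noiseProb_nonneg (hA : 0 < A) (hβ : 0 < β) (hγ : 0 < γ) (k : ℤ) :
    0 ≤ noiseProb A β γ k := by
  refine div_nonneg (sub_nonneg.2 (gaussQ_strictAnti.antitone ?_))
    (noiseProb_denom_pos hA hβ hγ).le
  rw [div_le_div_iff_of_pos_right hγ]
  linarith

lemma sum_Ico_int_sub_succ {G : Type*} [AddCommGroup G] (f : ℤ → G) {a b : ℤ} (hab : a ≤ b) :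
    ∑ k ∈ Finset.Ico a b, (f k - f (k + 1)) = f a - f b := by
  induction b, hab using Int.leInduction with
  | base => simp only [Ico_self, sum_empty, sub_self]
  | succ b hab ih =>
    rw [← insert_Ico_right_eq_Ico_add_one hab, sum_insert right_notMem_Ico, ih]
    abel

lemma sum_noiseProb (hA : 0 < A) (hβ : 0 < β) (hγ : 0 < γ) :
    ∑ k ∈ noiseRange A β γ, noiseProb A β γ k = 1 := by
  have hle : -⌈γ * A⌉ ≤ ⌈γ * (A + 2 * β)⌉ :=
    (neg_nonpos.2 (Int.ceil_nonneg (by positivity))).trans (Int.ceil_nonneg (by positivity))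
  have htelescope := sum_Ico_int_sub_succ (fun k : ℤ => gaussQ (((k : ℝ) - γ * β) / γ)) hle
  push_cast at htelescope
  simp only [noiseProb, ← sum_div, noiseRange]
  rw [htelescope, div_self (noiseProb_denom_pos hA hβ hγ).ne']

lemma sum_noiseProb_noiseBit (hA : 0 < A) (hβ : 0 < β) (hγ : 0 < γ) {N : ℕ} (i : Fin N)
    (b : Bool) : ∑ k ∈ noiseRange A β γ with noiseBit N k i = b, noiseProb A β γ k =
      bern (alpha A β γ i) b := by
  cases b
  · simp only [bern, Bool.false_eq_true, if_false, alpha]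
    rw [eq_sub_iff_add_eq', ← sum_noiseProb hA hβ hγ, ← sum_filter_add_sum_filter_not
      (noiseRange A β γ) (fun k => noiseBit N k i = true) (noiseProb A β γ)]
    simp only [Bool.not_eq_true]
  · rfl

end Noise

section ChannelUse

variable {A β γ : ℝ} {N q : ℕ} {p : Fin N → ℝ}

lemma inputProb_mem_stdSimplex (hp : ∀ i, 0 ≤ p i ∧ p i ≤ 1) :
    inputProb p ∈ stdSimplex ℝ (Fin N → Bool) :=
  prodLaw_mem_stdSimplex fun i => bern_mem_stdSimplex (hp i).1 (hp i).2

lemma prob_congr (p : Fin N → ℝ) {F G : (Fin N → Bool) → ℤ → Prop} (h : ∀ x k, F x k ↔ G x k) :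
    prob A β γ p F = prob A β γ p G := by
  rw [show F = G from funext₂ fun x k => propext (h x k)]

lemma prob_nonneg (hA : 0 < A) (hβ : 0 < β) (hγ : 0 < γ) (hp : ∀ i, 0 ≤ p i ∧ p i ≤ 1)
    (F : (Fin N → Bool) → ℤ → Prop) : 0 ≤ prob A β γ p F := by
  refine sum_nonneg fun x _ => sum_nonneg fun k _ => ?_
  split_ifs
  exacts [mul_nonneg ((inputProb_mem_stdSimplex hp).1 x) (noiseProb_nonneg hA hβ hγ k), le_rfl]

lemma prob_and_add_prob_and_not (p : Fin N → ℝ) (F G : (Fin N → Bool) → ℤ → Prop) :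
    prob A β γ p (fun x k => F x k ∧ G x k) + prob A β γ p (fun x k => F x k ∧ ¬ G x k) =
      prob A β γ p F := by
  simp only [prob, ← sum_add_distrib]
  refine sum_congr rfl fun x _ => sum_congr rfl fun k _ => ?_
  by_cases hF : F x k <;> by_cases hG : G x k <;> simp [hF, hG]

lemma prob_input_and (p : Fin N → ℝ) (i : Fin N) (a : Bool) (G : ℤ → Prop) [DecidablePred G] :
    prob A β γ p (fun x k => x i = a ∧ G k) =
      bern (p i) a * ∑ k ∈ noiseRange A β γ with G k, noiseProb A β γ k := by
  rw [← mapLaw_prodLaw_eval (fun j => sum_bern (p j)) i, mapLaw, sum_mul_sum, sum_filter, prob]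
  refine sum_congr rfl fun x _ => ?_
  rw [sum_filter]
  by_cases hx : x i = a
  · simp only [hx, true_and, if_true]
    exact sum_congr rfl fun k _ => by congr
  · simp only [hx, false_and, if_false, sum_const_zero]

lemma prob_input (hA : 0 < A) (hβ : 0 < β) (hγ : 0 < γ) (p : Fin N → ℝ) (i : Fin N) (a : Bool) :
    prob A β γ p (fun x _ => x i = a) = bern (p i) a := by
  simpa [sum_noiseProb hA hβ hγ] using
    prob_input_and (A := A) (β := β) (γ := γ) p i a fun _ => True

lemma prob_input_noiseBit (hA : 0 < A) (hβ : 0 < β) (hγ : 0 < γ) (p : Fin N → ℝ) (i : Fin N)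
    (a b : Bool) : prob A β γ p (fun x k => x i = a ∧ noiseBit N k i = b) =
      bern (p i) a * bern (alpha A β γ i) b := by
  rw [prob_input_and p i a, sum_noiseProb_noiseBit hA hβ hγ]

lemma condProb_mul_prob (hA : 0 < A) (hβ : 0 < β) (hγ : 0 < γ) (hp : ∀ i, 0 ≤ p i ∧ p i ≤ 1)
    (F G : (Fin N → Bool) → ℤ → Prop) :
    condProb A β γ p F G * prob A β γ p G = prob A β γ p fun x k => F x k ∧ G x k := by
  refine div_mul_cancel_of_imp fun hG => ?_
  have hsplit := prob_and_add_prob_and_not (A := A) (β := β) (γ := γ) p G F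
  rw [prob_congr p fun x k => and_comm, hG] at hsplit
  linarith [prob_nonneg hA hβ hγ hp fun x k => F x k ∧ G x k,
    prob_nonneg hA hβ hγ hp fun x k => G x k ∧ ¬ F x k]

lemma flippedOutput_eq_true_iff (T : Fin N → Finset (Fin q → Bool)) (i : Fin N)
    (x : Fin N → Bool) (k : ℤ) :
    flippedOutput T i x k = true ↔ x i ≠ noiseBit N k i ∨ upper q (output x k) i ∈ T i := by
  have hcarry : xor (output x k i) (carry x k i) = xor (x i) (noiseBit N k i) := by
    rw [output, Bool.xor_assoc, Bool.xor_self, Bool.xor_false]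
  rw [flippedOutput, flipped, hcarry]
  cases x i <;> cases noiseBit N k i <;> simp

lemma prob_false_flipped_true (hA : 0 < A) (hβ : 0 < β) (hγ : 0 < γ)
    (hp : ∀ i, 0 ≤ p i ∧ p i ≤ 1) (T : Fin N → Finset (Fin q → Bool)) (i : Fin N) :
    prob A β γ p (fun x k => x i = false ∧ flippedOutput T i x k = true) =
      (1 - p i) * alphaZero A β γ T p i := by
  have hnoise : ∀ x k, ((x i = false ∧ flippedOutput T i x k = true) ∧ noiseBit N k i = true) ↔
      x i = false ∧ noiseBit N k i = true := by
    intro x k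
    rw [flippedOutput_eq_true_iff]
    cases x i <;> cases noiseBit N k i <;> simp
  have hflip : ∀ x k, ((x i = false ∧ flippedOutput T i x k = true) ∧ ¬ noiseBit N k i = true) ↔
      upper q (output x k) i ∈ T i ∧ x i = false ∧ noiseBit N k i = false := by
    intro x k
    rw [flippedOutput_eq_true_iff]
    cases x i <;> cases noiseBit N k i <;> simp
  rw [← prob_and_add_prob_and_not p _ fun _ k => noiseBit N k i = true, prob_congr p hnoise,
    prob_congr p hflip, prob_input_noiseBit hA hβ hγ, ← condProb_mul_prob hA hβ hγ hp,
    prob_input_noiseBit hA hβ hγ]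
  simp only [bern, alphaZero, theta, Bool.false_eq_true, if_false, if_true]
  ring

lemma prob_true_flipped_false (hA : 0 < A) (hβ : 0 < β) (hγ : 0 < γ)
    (hp : ∀ i, 0 ≤ p i ∧ p i ≤ 1) (T : Fin N → Finset (Fin q → Bool)) (i : Fin N) :
    prob A β γ p (fun x k => x i = true ∧ flippedOutput T i x k = false) =
      p i * alphaOne A β γ T p i := by
  have hsplit := prob_and_add_prob_and_not (A := A) (β := β) (γ := γ) p
    (fun x k => x i = true ∧ noiseBit N k i = true) fun x k => upper q (output x k) i ∈ T i
  have hkept : ∀ x k, ((x i = true ∧ noiseBit N k i = true) ∧ ¬ upper q (output x k) i ∈ T i) ↔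
      x i = true ∧ flippedOutput T i x k = false := by
    intro x k
    rw [← Bool.not_eq_true (flippedOutput T i x k), flippedOutput_eq_true_iff]
    cases x i <;> cases noiseBit N k i <;> simp
  rw [prob_congr p hkept, prob_congr p fun x k => and_comm, ← condProb_mul_prob hA hβ hγ hp,
    prob_input_noiseBit hA hβ hγ] at hsplit
  simp only [bern, if_true] at hsplit
  rw [← eq_sub_iff_add_eq'] at hsplit
  rw [hsplit, alphaOne, thetaBar]
  ring

/-- The joint law of the input and the flipped output of bit-pipe `i` in one unerased channel
use. -/
def bitLaw (A β γ : ℝ) (T : Fin N → Finset (Fin q → Bool)) (p : Fin N → ℝ) (i : Fin N)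
    (r : Bool × Bool) : ℝ :=
  prob A β γ p fun x k => x i = r.1 ∧ flippedOutput T i x k = r.2

/-- The probability that the flipped output of bit-pipe `i` is `1` when its input is `a`. -/
def flippedTrueProb (A β γ : ℝ) (T : Fin N → Finset (Fin q → Bool)) (p : Fin N → ℝ) (i : Fin N)
    (a : Bool) : ℝ :=
  if a then 1 - alphaOne A β γ T p i else alphaZero A β γ T p i

lemma sum_bitLaw_mk (hA : 0 < A) (hβ : 0 < β) (hγ : 0 < γ) (T : Fin N → Finset (Fin q → Bool))
    (p : Fin N → ℝ) (i : Fin N) (a : Bool) : ∑ b, bitLaw A β γ T p i (a, b) = bern (p i) a := by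
  rw [Fintype.sum_bool, ← prob_input hA hβ hγ p i a,
    ← prob_and_add_prob_and_not p _ fun x k => flippedOutput T i x k = true]
  simp only [bitLaw, Bool.not_eq_true]

lemma sum_bitLaw (hA : 0 < A) (hβ : 0 < β) (hγ : 0 < γ) (T : Fin N → Finset (Fin q → Bool))
    (p : Fin N → ℝ) (i : Fin N) : ∑ r, bitLaw A β γ T p i r = 1 := by
  simp only [Fintype.sum_prod_type, sum_bitLaw_mk hA hβ hγ, sum_bern]

lemma bitLaw_eq (hA : 0 < A) (hβ : 0 < β) (hγ : 0 < γ) (hp : ∀ i, 0 ≤ p i ∧ p i ≤ 1)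
    (T : Fin N → Finset (Fin q → Bool)) (i : Fin N) (a b : Bool) :
    bitLaw A β γ T p i (a, b) = bern (p i) a * bern (flippedTrueProb A β γ T p i a) b := by
  have hsum := sum_bitLaw_mk hA hβ hγ T p i a
  have hft : bitLaw A β γ T p i (false, true) = _ := prob_false_flipped_true hA hβ hγ hp T i
  have htf : bitLaw A β γ T p i (true, false) = _ := prob_true_flipped_false hA hβ hγ hp T i
  rw [Fintype.sum_bool] at hsum
  cases a <;> cases b <;>
    simp only [bern, flippedTrueProb, Bool.false_eq_true, if_false, if_true] at hsum ⊢ <;> linarith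

lemma condProb_flippedOutput (hA : 0 < A) (hβ : 0 < β) (hγ : 0 < γ)
    (hp : ∀ i, 0 ≤ p i ∧ p i ≤ 1) (T : Fin N → Finset (Fin q → Bool)) {i : Fin N} {a : Bool}
    (ha : bern (p i) a ≠ 0) (b : Bool) :
    condProb A β γ p (fun x k => flippedOutput T i x k = b) (fun x _ => x i = a) =
      bern (flippedTrueProb A β γ T p i a) b := by
  rw [condProb, prob_input hA hβ hγ, prob_congr p fun x k => and_comm]
  exact (congrArg (· / _) (bitLaw_eq hA hβ hγ hp T i a b)).trans (mul_div_cancel_left₀ _ ha)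

lemma bitLaw_nonneg (hA : 0 < A) (hβ : 0 < β) (hγ : 0 < γ) (hp : ∀ i, 0 ≤ p i ∧ p i ≤ 1)
    (T : Fin N → Finset (Fin q → Bool)) (i : Fin N) (r : Bool × Bool) :
    0 ≤ bitLaw A β γ T p i r :=
  prob_nonneg hA hβ hγ hp _

lemma Phi_mul_log_two (hA : 0 < A) (hβ : 0 < β) (hγ : 0 < γ) (hp : ∀ i, 0 ≤ p i ∧ p i ≤ 1)
    (T : Fin N → Finset (Fin q → Bool)) (i : Fin N) :
    Phi A β γ T p i * Real.log 2 = mutualInfoNats (bitLaw A β γ T p i) := by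
  have hlog : Real.log 2 ≠ 0 := (Real.log_pos one_lt_two).ne'
  rw [mutualInfoNats_binary_channel (bitLaw_nonneg hA hβ hγ hp T i)
    (bitLaw_eq hA hβ hγ hp T i)]
  simp only [Phi, hBin, bern, flippedTrueProb, Fintype.sum_bool, if_true, Bool.false_eq_true,
    if_false, Real.binEntropy_one_sub]
  rw [add_comm (p i * _)]
  field_simp
  ring

lemma Phi_nonneg (hA : 0 < A) (hβ : 0 < β) (hγ : 0 < γ) (hp : ∀ i, 0 ≤ p i ∧ p i ≤ 1)
    (T : Fin N → Finset (Fin q → Bool)) (i : Fin N) : 0 ≤ Phi A β γ T p i := by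
  have hlaw : bitLaw A β γ T p i ∈ stdSimplex ℝ (Bool × Bool) :=
    ⟨bitLaw_nonneg hA hβ hγ hp T i, sum_bitLaw hA hβ hγ T p i⟩
  refine nonneg_of_mul_nonneg_left ?_ (Real.log_pos one_lt_two)
  rw [Phi_mul_log_two hA hβ hγ hp]
  exact mutualInfoNats_nonneg hlaw

lemma Phi_eq_mutualInfo (hA : 0 < A) (hβ : 0 < β) (hγ : 0 < γ) (hp : ∀ i, 0 ≤ p i ∧ p i ≤ 1)
    (T : Fin N → Finset (Fin q → Bool)) (i : Fin N) :
    Phi A β γ T p i = mutualInfo fun a b => bitLaw A β γ T p i (a, b) :=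
  mul_right_cancel₀ (Real.log_pos one_lt_two).ne' <| by
    rw [Phi_mul_log_two hA hβ hγ hp, mutualInfo_mul_log_two]

lemma continuous_bitLaw (T : Fin N → Finset (Fin q → Bool)) (i : Fin N) (r : Bool × Bool) :
    Continuous fun p : Fin N → ℝ => bitLaw A β γ T p i r := by
  unfold bitLaw prob inputProb
  refine continuous_finsetSum _ fun x _ => continuous_finsetSum _ fun k _ => ?_
  split_ifs
  · refine (continuous_finsetProd _ fun j _ => ?_).mul continuous_const
    split_ifs <;> fun_prop
  · exact continuous_const

lemma continuousOn_Phi (hA : 0 < A) (hβ : 0 < β) (hγ : 0 < γ)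
    (T : Fin N → Finset (Fin q → Bool)) (i : Fin N) :
    ContinuousOn (fun p : Fin N → ℝ => Phi A β γ T p i) {p | ∀ i, 0 ≤ p i ∧ p i ≤ 1} := by
  have hlog : Real.log 2 ≠ 0 := (Real.log_pos one_lt_two).ne'
  have hbit := continuous_bitLaw (A := A) (β := β) (γ := γ) T i
  have hcont : Continuous fun p : Fin N → ℝ =>
      (∑ a, Real.negMulLog (∑ b, bitLaw A β γ T p i (a, b)) +
        ∑ b, Real.negMulLog (∑ a, bitLaw A β γ T p i (a, b)) -
        ∑ r, Real.negMulLog (bitLaw A β γ T p i r)) / Real.log 2 := by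
    have := Real.continuous_negMulLog
    fun_prop
  refine hcont.continuousOn.congr fun p hp => ?_
  rw [eq_div_iff hlog, Phi_mul_log_two hA hβ hγ hp,
    mutualInfoNats_eq_sum_negMulLog (bitLaw_nonneg hA hβ hγ hp T i)]
  simp only [mapLaw_fst, mapLaw_snd]

lemma Phi_of_eq_zero (T : Fin N → Finset (Fin q → Bool)) {i : Fin N} (hi : p i = 0) :
    Phi A β γ T p i = 0 := by
  simp [Phi, hi]

end ChannelUse

section Feasible

variable {A E γ : ℝ} {N : ℕ}

lemma sum_filter_pos_mul {ι : Type*} [Fintype ι] {p : ι → ℝ} (hp : ∀ i, 0 ≤ p i) (c : ι → ℝ) :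
    ∑ i with 0 < p i, p i * c i = ∑ i, p i * c i :=
  sum_filter_of_ne fun i _ hi => (hp i).lt_of_ne' (left_ne_zero_of_mul hi)

lemma isCompact_feasible (A E γ : ℝ) (N : ℕ) : IsCompact {p : Fin N → ℝ | Feasible A E γ p} := by
  have hbox : IsCompact (Set.univ.pi fun _ : Fin N => Set.Icc (0 : ℝ) 1) :=
    isCompact_univ_pi fun _ => isCompact_Icc
  have hpeak : LowerSemicontinuous fun p : Fin N → ℝ =>
      ∑ i, ({p | 0 < p i} : Set (Fin N → ℝ)).indicator (fun _ => (2 : ℝ) ^ (i : ℕ)) p :=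
    lowerSemicontinuous_sum fun i _ =>
      (isOpen_lt continuous_const (continuous_apply i)).lowerSemicontinuous_indicator
        (by positivity)
  have hmean : Continuous fun p : Fin N → ℝ => ∑ i, p i * (2 : ℝ) ^ (i : ℕ) := by fun_prop
  convert! (hbox.inter_right (hpeak.isClosed_preimage (γ * A))).inter_right
    (isClosed_Iic.preimage hmean : IsClosed (_ ⁻¹' Set.Iic (γ * E))) using 1
  ext p
  constructor
  · rintro ⟨h01, hA, hE⟩
    refine ⟨⟨fun i _ => h01 i, ?_⟩, ?_⟩
    · simpa [Set.indicator_apply, sum_filter] using hA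
    · simpa [sum_filter_pos_mul fun i => (h01 i).1] using hE
  · rintro ⟨⟨h01, hA⟩, hE⟩
    have h0 : ∀ i, 0 ≤ p i := fun i => (h01 i trivial).1
    refine ⟨fun i => h01 i trivial, ?_, ?_⟩
    · simpa [Set.indicator_apply, sum_filter] using hA
    · simpa [sum_filter_pos_mul h0] using hE

lemma feasible_zero (hA : 0 < A) (hE : 0 < E) (hγ : 0 < γ) (N : ℕ) :
    Feasible A E γ (0 : Fin N → ℝ) := by
  refine ⟨fun i => ⟨le_rfl, zero_le_one⟩, ?_, ?_⟩
  · simpa using (mul_pos hγ hA).le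
  · simpa using (mul_pos hγ hE).le

end Feasible

section Receiver

variable {N n q : ℕ}

/-- The carry bits that a receiver deduces from the input `x` and the output `v` of the vector
binary channel. -/
def carryOf (x v : Fin N → Bool) : ℕ → Bool
  | 0 => false
  | i + 1 =>
    carryOut (bitAt x i) (xor (xor (bitAt v i) (bitAt x i)) (carryOf x v i)) (carryOf x v i)

lemma carryOf_output (x : Fin N → Bool) (k : ℤ) {i : ℕ} (hi : i ≤ N) :
    carryOf x (output x k) i = carry x k i := by
  induction i with
  | zero => rfl
  | succ i ih =>
    rw [carryOf, carry, ih (Nat.le_of_succ_le hi)]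
    congr 1
    simp only [bitAt, Nat.lt_of_succ_le hi, dif_pos, output]
    cases x ⟨i, hi⟩ <;> cases noiseBit N k i <;> cases carry x k i <;> rfl

/-- The symbol that a receiver with correct carry bits hands to the decoder of bit-pipe `i`, for the
channel input `s.1` and the channel output `s.2`. -/
def observe (T : Fin N → Finset (Fin q → Bool)) (i : Fin N)
    (s : (Fin N → Bool) × Option (Fin N → Bool)) : Option Bool :=
  s.2.map fun v => flipped (T i) v (carryOf s.1 v i) i

namespace Code

variable (C : Code N n) (T : Fin N → Finset (Fin q → Bool)) (y : Fin n → Option (Fin N → Bool))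
  (m : (i : Fin N) → Fin (C.size i))

lemma decoderInput_eq_observe (x : Fin n → Fin N → Bool) {w : Fin n → Bool} {i : Fin N}
    (hw : ∀ t v, y t = some v → w t = carryOf (x t) v i) :
    decoderInput T y w i = fun t => observe T i (x t, y t) := by
  funext t
  rw [decoderInput, observe]
  cases hy : y t with
  | none => rfl
  | some v => rw [Option.map_some, Option.map_some, hw t v hy]

lemma carryEst_eq_carryOf (hm : ∀ i, C.dec i (fun t => observe T i (C.input m t, y t)) = m i)
    {i : ℕ} (hi : i ≤ N) (t : Fin n) (v : Fin N → Bool) (hv : y t = some v) :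
    C.carryEst T y i t = carryOf (C.input m t) v i := by
  induction i generalizing t v with
  | zero => rfl
  | succ i ih =>
    have hiN : i < N := hi
    have hinput := decoderInput_eq_observe T y (C.input m) (i := ⟨i, hiN⟩) (ih hiN.le)
    simp only [carryEst, hiN, dif_pos, hv, hinput, hm, ih hiN.le t v hv, carryOf, bitAt]
    rfl

lemma decide_eq_of_forall_dec_eq
    (hm : ∀ i, C.dec i (fun t => observe T i (C.input m t, y t)) = m i) : C.decide T y = m := by
  funext i
  rw [← hm i, decide, decoderInput_eq_observe T y (C.input m)
    (carryEst_eq_carryOf C T y m hm i.2.le)]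

lemma errorProb_le {A β γ ε : ℝ} (hW : ∀ x y, 0 ≤ transProb A β γ ε (N := N) x y) :
    C.errorProb A β γ ε T ≤
      (∑ m, wrongProb (transProb A β γ ε) (observe T) C.enc C.dec m) / ∏ i, (C.size i : ℝ) := by
  refine div_le_div_of_nonneg_right (sum_le_sum fun m _ => sum_le_sum fun y _ => ?_)
    (prod_nonneg fun i _ => Nat.cast_nonneg _)
  split_ifs with hdecide hdec hdec
  · rw [mul_zero]
  · exact mul_nonneg (prodLaw_nonneg (fun t => hW _) y) zero_le_one
  · exact absurd (C.decide_eq_of_forall_dec_eq T y m hdec) hdecide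
  · exact (mul_one _).ge

end Code

end Receiver

section ErasureChannel

variable {A β γ ε : ℝ} {N q : ℕ}

lemma sum_transProb_some_mul (A β γ ε : ℝ) (x : Fin N → Bool) (F : (Fin N → Bool) → ℝ) :
    ∑ v, transProb A β γ ε x (some v) * F v =
      (1 - ε) * ∑ k ∈ noiseRange A β γ, noiseProb A β γ k * F (output x k) := by
  simp only [transProb, mul_assoc, ← mul_sum, sum_mul, ite_mul, zero_mul]
  rw [Finset.sum_comm]
  simp only [sum_ite_eq, mem_univ, if_true]

lemma transProb_mem_stdSimplex (hA : 0 < A) (hβ : 0 < β) (hγ : 0 < γ) (h0 : 0 ≤ ε) (h1 : ε ≤ 1)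
    (x : Fin N → Bool) : transProb A β γ ε x ∈ stdSimplex ℝ (Option (Fin N → Bool)) := by
  constructor
  · rintro (_ | v)
    · exact h0
    · refine mul_nonneg (sub_nonneg.2 h1) (sum_nonneg fun k _ => ?_)
      split_ifs
      exacts [noiseProb_nonneg hA hβ hγ k, le_rfl]
  · have hsome := sum_transProb_some_mul A β γ ε x fun _ => 1
    simp only [mul_one, sum_noiseProb hA hβ hγ] at hsome
    rw [Fintype.sum_option, hsome, transProb, add_sub_cancel]

lemma pipeLaw_mk {X Y V : Type*} [Fintype X] [Fintype Y] [DecidableEq X] [DecidableEq V]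
    (μ : Fin N → X → ℝ) (W : (Fin N → X) → Y → ℝ) (g : (Fin N → X) × Y → V) (i : Fin N) (a : X)
    (v : V) : pipeLaw μ W g i (a, v) =
      ∑ x with x i = a, prodLaw μ x * ∑ y, W x y * if g (x, y) = v then 1 else 0 := by
  rw [pipeLaw, mapLaw_eq_sum_mul_indicator, Fintype.sum_prod_type, sum_filter]
  refine sum_congr rfl fun x _ => ?_
  rw [mul_sum]
  split_ifs with hx
  · refine sum_congr rfl fun y _ => ?_
    rw [jointLaw, mul_assoc]
    congr 2
    by_cases hv : g (x, y) = v <;> simp [hx, hv]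
  · exact sum_eq_zero fun y _ => by simp [hx]

lemma pipeLaw_transProb (hA : 0 < A) (hβ : 0 < β) (hγ : 0 < γ) (p : Fin N → ℝ)
    (T : Fin N → Finset (Fin q → Bool)) (i : Fin N) :
    pipeLaw (fun j => bern (p j)) (transProb A β γ ε) (observe T i) i =
      eraseLaw ε (bitLaw A β γ T p i) := by
  classical
  ext ⟨a, _ | b⟩
  · have hx : ∀ x, ∑ y, transProb A β γ ε x y * (if observe T i (x, y) = none then 1 else 0) =
        ε := fun x => by simp [observe, transProb]
    simp only [pipeLaw_mk, hx, ← sum_mul]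
    rw [eraseLaw, mapLaw_fst, sum_bitLaw_mk hA hβ hγ, mul_comm,
      ← mapLaw_prodLaw_eval (fun j => sum_bern (p j)) i, mapLaw]
    congr!
  · have hflip : ∀ x k, flipped (T i) (output x k) (carryOf x (output x k) i) i =
        flippedOutput T i x k := fun x k => by rw [carryOf_output x k i.2.le, flippedOutput]
    have hx : ∀ x, ∑ y, transProb A β γ ε x y * (if observe T i (x, y) = some b then 1 else 0) =
        (1 - ε) * ∑ k ∈ noiseRange A β γ,
          noiseProb A β γ k * if flippedOutput T i x k = b then 1 else 0 := fun x => by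
      rw [Fintype.sum_option]
      simp only [observe, Option.map_none, Option.map_some, reduceCtorEq, if_false, mul_zero,
        zero_add, Option.some.injEq, sum_transProb_some_mul, hflip]
    simp only [pipeLaw_mk, hx, mul_left_comm _ (1 - ε), ← mul_sum]
    rw [eraseLaw, bitLaw, prob, sum_filter]
    refine congrArg _ (sum_congr rfl fun x _ => ?_)
    by_cases hxa : x i = a <;> simp [hxa, mul_sum, inputProb, prodLaw, bern]

lemma mutualInfoNats_pipeLaw_transProb (hA : 0 < A) (hβ : 0 < β) (hγ : 0 < γ) {p : Fin N → ℝ}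
    (hp : ∀ i, 0 ≤ p i ∧ p i ≤ 1) (T : Fin N → Finset (Fin q → Bool)) (i : Fin N) :
    mutualInfoNats (pipeLaw (fun j => bern (p j)) (transProb A β γ ε) (observe T i) i) =
      (1 - ε) * Phi A β γ T p i * Real.log 2 := by
  rw [pipeLaw_transProb hA hβ hγ, mutualInfoNats_eraseLaw ε (sum_bitLaw hA hβ hγ T p i), mul_assoc,
    Phi_mul_log_two hA hβ hγ hp]

end ErasureChannel

section Achievability

variable {A E β γ ε : ℝ} {N n q : ℕ} {p : Fin N → ℝ}

lemma Achieves.mono {T : Fin N → Finset (Fin q → Bool)} {R R' : ℝ}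
    (hR : Achieves A E β γ ε T p R) (hle : R' ≤ R) : Achieves A E β γ ε T p R' :=
  fun r hr => hR r (hr.trans_le hle)

namespace Code

lemma respectsOff_of_weight_le {C : Code N n} (hsize : ∀ i, p i = 0 → C.size i = 1)
    (hweight : ∀ i m, ∑ t, bern 1 (C.enc i m t) ≤ n * p i) : C.RespectsOff p := by
  refine fun i hi => ⟨hsize i hi, fun m t => ?_⟩
  have hbern : ∀ b, 0 ≤ bern 1 b := (bern_mem_stdSimplex zero_le_one le_rfl).1
  have hle : bern 1 (C.enc i m t) ≤ 0 :=
    (single_le_sum (fun t _ => hbern (C.enc i m t)) (mem_univ t)).trans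
      ((hweight i m).trans_eq (by rw [hi, mul_zero]))
  rw [← Bool.not_eq_true]
  intro htrue
  simp only [htrue, bern, if_true] at hle
  exact one_pos.not_ge hle

lemma meetsConstraints_of_weight_le (hγ : 0 < γ) (hp : Feasible A E γ p) {C : Code N n}
    (hoff : C.RespectsOff p) (hweight : ∀ i m, ∑ t, bern 1 (C.enc i m t) ≤ n * p i) :
    C.MeetsConstraints A E γ := by
  obtain ⟨h01, hpeak, hmean⟩ := hp
  refine fun m => ⟨fun t => ?_, ?_⟩
  · rw [intensity, div_le_iff₀' hγ]
    refine le_trans ?_ hpeak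
    rw [sum_filter]
    refine sum_le_sum fun i _ => ?_
    rcases (h01 i).1.eq_or_lt' with hi | hi
    · simp [input, (hoff i hi).2, hi]
    · rw [if_pos hi]
      split_ifs
      exacts [le_rfl, by positivity]
  · rw [sum_filter_pos_mul fun i => (h01 i).1] at hmean
    simp only [intensity]
    rw [← sum_div, div_le_iff₀ hγ, sum_comm]
    calc ∑ i, ∑ t, (if C.input m t i then (2 : ℝ) ^ (i : ℕ) else 0)
        = ∑ i, (∑ t, bern 1 (C.enc i (m i) t)) * (2 : ℝ) ^ (i : ℕ) := by
          simp only [input, sum_mul, bern, sub_self, ite_mul, one_mul, zero_mul]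
          rfl
      _ ≤ ∑ i, n * p i * (2 : ℝ) ^ (i : ℕ) :=
          sum_le_sum fun i _ => mul_le_mul_of_nonneg_right (hweight i (m i)) (by positivity)
      _ = n * ∑ i, p i * (2 : ℝ) ^ (i : ℕ) := by simp only [mul_sum, mul_assoc]
      _ ≤ n * (γ * E) := mul_le_mul_of_nonneg_left hmean n.cast_nonneg
      _ = n * E * γ := by ring

lemma sum_le_rate_mul_log_two (hn : 0 < n) {C : Code N n} {R : Fin N → ℝ}
    (hR : ∀ i, Real.exp (n * R i) ≤ C.size i) : ∑ i, R i ≤ C.rate * Real.log 2 := by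
  have hlog : Real.log 2 ≠ 0 := (Real.log_pos one_lt_two).ne'
  rw [rate, div_mul_eq_mul_div, le_div_iff₀' (Nat.cast_pos.2 hn), mul_sum, sum_mul]
  refine sum_le_sum fun i _ => ?_
  rw [Real.logb, div_mul_cancel₀ _ hlog]
  exact (Real.le_log_iff_exp_le (Nat.cast_pos.2 (C.size_pos i))).2 (hR i)

end Code

lemma exists_forall_lt_and_le_sum {ι : Type*} [Fintype ι] {a : ι → ℝ} {R : ℝ} (h : R < ∑ i, a i) :
    ∃ r : ι → ℝ, (∀ i, r i < a i) ∧ R ≤ ∑ i, r i := by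
  set η : ℝ := (∑ i, a i - R) / (Fintype.card ι + 1)
  have hη0 : 0 < η := div_pos (sub_pos.2 h) (by positivity)
  have hcard : (Fintype.card ι + 1) * η = ∑ i, a i - R := mul_div_cancel₀ _ (by positivity)
  refine ⟨fun i => a i - η, fun i => sub_lt_self _ hη0, ?_⟩
  rw [sum_sub_distrib, sum_const, card_univ, nsmul_eq_mul]
  linarith

lemma achieves_of_lt (hA : 0 < A) (hβ : 0 < β) (hγ : 0 < γ) (h0 : 0 ≤ ε) (h1 : ε ≤ 1)
    (T : Fin N → Finset (Fin q → Bool)) {p' : Fin N → ℝ} (hp : Feasible A E γ p)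
    (hp' : ∀ i, 0 ≤ p' i ∧ p' i ≤ 1) (hpp : ∀ i, p' i < p i ∨ p' i = 0 ∧ p i = 0) :
    Achieves A E β γ ε T p ((1 - ε) * ∑ i, Phi A β γ T p' i) := by
  intro R' hR' δ hδ
  have hlog : 0 < Real.log 2 := Real.log_pos one_lt_two
  have hW := transProb_mem_stdSimplex (N := N) hA hβ hγ h0 h1
  rw [← mul_lt_mul_iff_left₀ hlog, mul_sum, sum_mul] at hR'
  obtain ⟨R, hR, hR'⟩ := exists_forall_lt_and_le_sum hR'
  have hcost : ∀ i, ∑ a, bern (p' i) a * bern 1 a < p i ∨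
      ∀ a, bern (p' i) a ≠ 0 → bern 1 a ≤ p i := fun i => by
    refine (hpp i).imp (fun h => by simpa [bern] using h) fun h => ?_
    simp [bern, h]
  obtain ⟨n₀, hn₀⟩ := eventually_atTop.1 <| eventually_exists_codebook
    (fun i => bern_mem_stdSimplex (hp' i).1 (hp' i).2) hW (observe T) hcost
    (fun i => (hR i).trans_eq (mutualInfoNats_pipeLaw_transProb hA hβ hγ hp' T i).symm) hδ
  refine ⟨n₀ + 1, fun n hn => ?_⟩
  have hsize : ∀ i, 0 < ⌈Real.exp (n * R i)⌉₊ := fun i => Nat.ceil_pos.2 (Real.exp_pos _)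
  obtain ⟨enc, dec, hweight, herr⟩ := hn₀ n (Nat.le_of_succ_le hn) _ hsize
    fun i => (sub_lt_iff_lt_add.2 (Nat.ceil_lt_add_one (Real.exp_pos _).le)).le
  let C : Code N n := ⟨_, hsize, enc, dec⟩
  have hone : ∀ i, p i = 0 → C.size i = 1 := fun i hi => by
    have hp'0 : p' i = 0 := (hpp i).elim (fun h => absurd (h.trans_eq hi) (hp' i).1.not_gt) And.left
    have hRi : R i < 0 := by simpa [Phi_of_eq_zero T hp'0] using hR i
    refine le_antisymm (Nat.ceil_le.2 ?_) (hsize i)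
    rw [Nat.cast_one, Real.exp_le_one_iff]
    exact mul_nonpos_of_nonneg_of_nonpos n.cast_nonneg hRi.le
  have hoff : C.RespectsOff p := Code.respectsOff_of_weight_le hone hweight
  refine ⟨C, hoff, Code.meetsConstraints_of_weight_le hγ hp hoff hweight, ?_, ?_⟩
  · exact le_of_mul_le_mul_right
      (hR'.trans (Code.sum_le_rate_mul_log_two (Nat.zero_lt_of_lt hn) fun i => Nat.le_ceil _)) hlog
  · refine (C.errorProb_le T fun x => (hW x).1).trans ?_
    rw [div_le_iff₀' (prod_pos fun i _ => Nat.cast_pos.2 (hsize i)), ← Nat.cast_prod]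
    exact herr

theorem achieves_of_feasible (hA : 0 < A) (hβ : 0 < β) (hγ : 0 < γ) (h0 : 0 ≤ ε) (h1 : ε ≤ 1)
    (T : Fin N → Finset (Fin q → Bool)) (hp : Feasible A E γ p) :
    Achieves A E β γ ε T p ((1 - ε) * ∑ i, Phi A β γ T p i) := by
  intro R' hR'
  have hbox : ∀ τ ∈ Set.Ioo (0 : ℝ) 1, ∀ i, 0 ≤ (τ • p) i ∧ (τ • p) i ≤ 1 := fun τ hτ i =>
    ⟨mul_nonneg hτ.1.le (hp.1 i).1, mul_le_one₀ hτ.2.le (hp.1 i).1 (hp.1 i).2⟩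
  have hscale : Tendsto (fun τ : ℝ => τ • p) (nhdsWithin 1 (Set.Ioo 0 1))
      (nhdsWithin p {p | ∀ i, 0 ≤ p i ∧ p i ≤ 1}) := by
    refine tendsto_nhdsWithin_iff.2 ⟨tendsto_nhdsWithin_of_tendsto_nhds ?_,
      eventually_nhdsWithin_of_forall hbox⟩
    exact (by fun_prop : Continuous fun τ : ℝ => τ • p).tendsto' 1 p (one_smul ℝ p)
  have hrate : Tendsto (fun τ : ℝ => (1 - ε) * ∑ i, Phi A β γ T (τ • p) i)
      (nhdsWithin 1 (Set.Ioo 0 1)) (nhds ((1 - ε) * ∑ i, Phi A β γ T p i)) :=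
    (tendsto_finsetSum _ fun i _ =>
      ((continuousOn_Phi hA hβ hγ T i) p hp.1).tendsto.comp hscale).const_mul _
  have : (nhdsWithin (1 : ℝ) (Set.Ioo 0 1)).NeBot := right_nhdsWithin_Ioo_neBot zero_lt_one
  obtain ⟨τ, hτR, hτ⟩ := ((hrate.eventually_const_lt hR').and self_mem_nhdsWithin).exists
  refine achieves_of_lt hA hβ hγ h0 h1 T hp (hbox τ hτ) (fun i => ?_) R' hτR
  rcases (hp.1 i).1.eq_or_lt' with hi | hi
  · exact .inr ⟨by simp [hi], hi⟩
  · exact .inl (mul_lt_of_lt_one_left hi hτ.2)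

lemma exists_feasible_forall_sum_Phi_le (hA : 0 < A) (hE : 0 < E) (hβ : 0 < β) (hγ : 0 < γ)
    (T : Fin N → Finset (Fin q → Bool)) :
    ∃ p : Fin N → ℝ, Feasible A E γ p ∧ ∀ p' : Fin N → ℝ, Feasible A E γ p' →
      ∑ i, Phi A β γ T p' i ≤ ∑ i, Phi A β γ T p i := by
  have hcont : ContinuousOn (fun p : Fin N → ℝ => ∑ i, Phi A β γ T p i) {p | Feasible A E γ p} :=
    (continuousOn_finsetSum _ fun i _ => continuousOn_Phi hA hβ hγ T i).mono fun p hp => hp.1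
  obtain ⟨p, hp, hmax⟩ :=
    (isCompact_feasible A E γ N).exists_isMaxOn ⟨0, feasible_zero hA hE hγ N⟩ hcont
  exact ⟨p, hp, fun p' hp' => hmax hp'⟩

end Achievability

end

end CDBAC

open CDBAC in
theorem theorem6_general {A E β γ : ℝ} (hA : 0 < A) (hE : 0 < E) (hβ : 0 < β) (hγ : 0 < γ)
    {N q : ℕ} (T : Fin N → Finset (Fin q → Bool)) :
    (∀ p : Fin N → ℝ, (∀ i, 0 ≤ p i ∧ p i ≤ 1) → ∀ i : Fin N,
      (p i ≠ 1 → condProb A β γ p (fun x k => flippedOutput T i x k = true)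
        (fun x _ => x i = false) = alphaZero A β γ T p i) ∧
      (p i ≠ 0 → condProb A β γ p (fun x k => flippedOutput T i x k = false)
        (fun x _ => x i = true) = alphaOne A β γ T p i) ∧
      Phi A β γ T p i = mutualInfo (fun a b =>
        prob A β γ p (fun x k => x i = a ∧ flippedOutput T i x k = b))) ∧
    (∃ p : Fin N → ℝ, Feasible A E γ p ∧ ∀ p' : Fin N → ℝ, Feasible A E γ p' →
      ∑ i, Phi A β γ T p' i ≤ ∑ i, Phi A β γ T p i) ∧
    ∀ p : Fin N → ℝ, Feasible A E γ p → ∀ ε ε' : ℝ, 0 ≤ ε → ε ≤ ε' → ε' ≤ 1 →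
      Achieves A E β γ ε T p ((1 - ε') * ∑ i, Phi A β γ T p i) := by
  refine ⟨fun p hp i => ⟨fun h1 => ?_, fun h0 => ?_, Phi_eq_mutualInfo hA hβ hγ hp T i⟩,
    exists_feasible_forall_sum_Phi_le hA hE hβ hγ T, fun p hp ε ε' h0 hε h1 => ?_⟩
  · exact condProb_flippedOutput hA hβ hγ hp T (a := false) (sub_ne_zero.2 h1.symm) true
  · exact (condProb_flippedOutput hA hβ hγ hp T (a := true) h0 false).trans (sub_sub_cancel _ _)
  · exact (achieves_of_feasible hA hβ hγ h0 (hε.trans h1) T hp).mono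
      (mul_le_mul_of_nonneg_right (sub_le_sub_left hε 1)
        (Finset.sum_nonneg fun i _ => Phi_nonneg hA hβ hγ hp.1 T i))

theorem theorem6 (A E β γ : ℝ) (hA : 0 < A) (hE : 0 < E) (hEA : E ≤ A) (hβ : 0 < β) (hγ : 0 < γ)
    (N : ℕ) (hN : N = ⌈Real.logb 2 (γ * (A + 2 * β))⌉₊)
    (q : ℕ) (hq : 1 ≤ q) (hqN : q ≤ N - 1) (T : Fin N → Finset (Fin q → Bool)) :
    (∀ p : Fin N → ℝ, (∀ i, 0 ≤ p i ∧ p i ≤ 1) → ∀ i : Fin N,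
      (p i ≠ 1 → CDBAC.condProb A β γ p (fun x k => CDBAC.flippedOutput T i x k = true)
        (fun x _ => x i = false) = CDBAC.alphaZero A β γ T p i) ∧
      (p i ≠ 0 → CDBAC.condProb A β γ p (fun x k => CDBAC.flippedOutput T i x k = false)
        (fun x _ => x i = true) = CDBAC.alphaOne A β γ T p i) ∧
      CDBAC.Phi A β γ T p i = CDBAC.mutualInfo (fun a b =>
        CDBAC.prob A β γ p (fun x k => x i = a ∧ CDBAC.flippedOutput T i x k = b))) ∧
    ∃ p : Fin N → ℝ, CDBAC.Feasible A E γ p ∧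
      (∀ p' : Fin N → ℝ, CDBAC.Feasible A E γ p' →
        ∑ i, CDBAC.Phi A β γ T p' i ≤ ∑ i, CDBAC.Phi A β γ T p i) ∧
      ∀ ε : ℝ, 0 ≤ ε → ε ≤ CDBAC.epsBar β →
        CDBAC.Achieves A E β γ ε T p
          ((1 - CDBAC.epsBar β) * ∑ i, CDBAC.Phi A β γ T p i) := by
  obtain ⟨hΦ, ⟨p, hp, hmax⟩, hrate⟩ := theorem6_general hA hE hβ hγ T
  exact ⟨hΦ, p, hp, hmax, fun ε h0 hε => hrate p hp ε _ h0 hε (CDBAC.epsBar_lt_one hβ).le⟩
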